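/- Let $(X,d)$ be a geodesic metric space, i.e. for all $x,y\in X$ there is an isometric embedding $[0,d(x,y)]\to X$ with $0\mapsto x$ and $d(x,y)\mapsto y$. For $r>0$ let $\operatorname{Rips}(X,r)$ be (the geometric realization, with the weak topology, of) the open Vietoris–Rips complex: its vertex set is $X$ and its simplices are the nonempty finite subsets $\sigma\subseteq X$ with $\operatorname{Diam}(\sigma)<r$. For $p\le q$ let $i_{p,q}\colon \operatorname{Rips}(X,p)\to\operatorname{Rips}(X,q)$ be the inclusion. For $\bullet\in X$ and $s>0$ let $\mathcal D(X,s,\pi_1)\le \pi_1(X,\bullet)$ be the subgroup generated by the classes of all lassos $\alpha*\beta*\alpha^-$, where $\alpha$ is a path in $X$ starting at $\bullet$ and $\beta$ is a loop based at the endpoint of $\alpha$ with $\operatorname{Diam}(\beta)<s$; it is a normal subgroup. For an abelian group $G$ let $\mathcal D(X,s,G)\le H_1(X;G)$ (singular homology) be the subgroup generated by the classes of the cycles $g\cdot\beta$, where $g\in G$ and $\beta$ is a loop in $X$ with $\operatorname{Diam}(\beta)<s$. **Theorem (Persistence–diameter correspondence).** Let $X$ be a geodesic space. 1. For every $\bullet\in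 X$ there are group isomorphisms $$f_r\colon \pi_1(\operatorname{Rips}(X,r),\bullet)\xrightarrow{\ \cong\ }\pi_1(X,\bullet)/\mathcal D(X,\tfrac{3r}{2},\pi_1)\qquad(r>0)$$ which commute with the structure maps: for all $0<p\le q$, $f_q\circ\pi_1(i_{p,q})$ equals $f_p$ followed by the quotient map $\pi_1(X,\bullet)/\mathcal D(X,\tfrac{3p}{2},\pi_1)\to\pi_1(X,\bullet)/\mathcal D(X,\tfrac{3q}{2},\pi_1)$. 2. For every abelian group $G$ there are group isomorphisms $$h_r\colon H_1(\operatorname{Rips}(X,r);G)\xrightarrow{\ \cong\ }H_1(X;G)/\mathcal D(X,\tfrac{3r}{2},G)\qquad(r>0)$$ which commute with the structure maps: for all $0<p\le q$, $h_q\circ H_1(i_{p,q};G)$ equals $h_p$ followed by the quotient map $H_1(X;G)/\mathcal D(X,\tfrac{3p}{2},G)\to H_1(X;G)/\mathcal D(X,\tfrac{3q}{2},G)$. -/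

import Mathlib

universe u

namespace RipsPersistence

open CategoryTheory AlgebraicTopology

/-- A metric space is geodesic if any two points `x`, `y` are joined by an isometric embedding
of the interval `[0, dist x y]` that starts in `x` and ends in `y`. -/
def IsGeodesicSpace (X : Type u) [MetricSpace X] : Prop :=
  ∀ x y : X, ∃ γ : ℝ → X, γ 0 = x ∧ γ (dist x y) = y ∧
    ∀ s ∈ Set.Icc 0 (dist x y), ∀ t ∈ Set.Icc 0 (dist x y), dist (γ s) (γ t) = |s - t|

section Realization

variable {V : Type u}

/-- The points of the geometric realization of an abstract simplicial complex `K`: families of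
barycentric coordinates supported on a simplex of `K`. -/
@[ext]
structure Realization (K : AbstractSimplicialComplex V) : Type u where
  /-- the barycentric coordinates -/
  coord : V → ℝ
  nonneg : ∀ v, 0 ≤ coord v
  exists_face : ∃ σ ∈ K.faces, (∀ v, v ∉ σ → coord v = 0) ∧ ∑ v ∈ σ, coord v = 1

open Classical in
/-- The inclusion of the closed simplex spanned by a face `σ` of `K` into the realization. -/
noncomputable def Realization.face (K : AbstractSimplicialComplex V) (σ : K.faces)
    (s : stdSimplex ℝ (σ.1 : Finset V)) : Realization K where
  coord v := if h : v ∈ σ.1 then s.1 ⟨v, h⟩ else 0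
  nonneg v := by
    by_cases h : v ∈ σ.1
    · simpa [h] using s.2.1 ⟨v, h⟩
    · simp [h]
  exists_face := by
    refine ⟨σ.1, σ.2, fun v hv => by simp [hv], ?_⟩
    rw [← Finset.sum_coe_sort]
    simpa using s.2.2

/-- The weak topology: the finest one for which the inclusions of all closed simplices, with
their Euclidean topology, are continuous. -/
noncomputable instance (K : AbstractSimplicialComplex V) : TopologicalSpace (Realization K) :=
  ⨆ σ : K.faces, TopologicalSpace.coinduced (Realization.face K σ) inferInstance

theorem Realization.continuous_face (K : AbstractSimplicialComplex V) (σ : K.faces) :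
    Continuous (Realization.face K σ) :=
  continuous_iff_coinduced_le.2
    (le_iSup (fun σ : K.faces =>
      TopologicalSpace.coinduced (Realization.face K σ) inferInstance) σ)

theorem Realization.continuous_iff {K : AbstractSimplicialComplex V} {Y : Type*}
    [TopologicalSpace Y] (f : Realization K → Y) :
    Continuous f ↔ ∀ σ : K.faces, Continuous (f ∘ Realization.face K σ) := by
  constructor
  · intro hf σ
    exact hf.comp (Realization.continuous_face K σ)
  · intro h
    rw [continuous_iSup_dom]
    intro σ
    exact continuous_coinduced_dom.2 (h σ)

open Classical in
/-- A vertex of the complex, as a point of the realization. -/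
noncomputable def Realization.vertex (K : AbstractSimplicialComplex V) (v : V) : Realization K where
  coord w := if w = v then 1 else 0
  nonneg w := by split_ifs <;> norm_num
  exists_face := ⟨{v}, K.singleton_mem v, fun w hw => by simpa using hw, by simp⟩

/-- The map of realizations induced by the inclusion of a subcomplex. -/
noncomputable def Realization.incl {K L : AbstractSimplicialComplex V} (h : K ≤ L) :
    C(Realization K, Realization L) where
  toFun t :=
    { coord := t.coord
      nonneg := t.nonneg
      exists_face := by
        obtain ⟨σ, hσ, h'⟩ := t.exists_face
        exact ⟨σ, h hσ, h'⟩ }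
  continuous_toFun := by
    rw [Realization.continuous_iff]
    intro σ
    exact Realization.continuous_face L ⟨σ.1, h σ.2⟩

/-- The homomorphism of fundamental groups induced by the inclusion of a subcomplex; the base
point is a vertex of the smaller complex, and the inclusion fixes it. -/
noncomputable def piOneIncl {K L : AbstractSimplicialComplex V} (h : K ≤ L) (v : V) :
    FundamentalGroup (Realization K) (Realization.vertex K v) →*
      FundamentalGroup (Realization L) (Realization.vertex L v) :=
  FundamentalGroup.map (Realization.incl h) (Realization.vertex K v)

end Realization

/-- The open Vietoris-Rips complex at scale `r`: the simplices are the nonempty finite subsets of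
`X` of diameter less than `r`. -/
def rips (X : Type u) [MetricSpace X] (r : Set.Ioi (0 : ℝ)) : AbstractSimplicialComplex X where
  faces := {σ | σ.Nonempty ∧ Metric.diam (σ : Set X) < r.1}
  isRelLowerSet_faces := by
    rintro σ ⟨hσ, hd⟩
    refine ⟨hσ, fun τ hτ hne => ⟨hne, lt_of_le_of_lt ?_ hd⟩⟩
    exact Metric.diam_mono (Finset.coe_subset.2 hτ) σ.finite_toSet.isBounded
  singleton_mem v := ⟨Finset.singleton_nonempty v, by
    have h : (0 : ℝ) < r.1 := r.2
    simpa only [Finset.coe_singleton, Metric.diam_singleton] using h⟩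

theorem rips_mono {X : Type u} [MetricSpace X] {p q : Set.Ioi (0 : ℝ)} (h : p ≤ q) :
    rips X p ≤ rips X q :=
  fun _ hσ => ⟨hσ.1, lt_of_lt_of_le hσ.2 h⟩

section PiOne

variable {X : Type u} [MetricSpace X]

/-- The subgroup of `π₁(X, x₀)` generated by the lassos `α * β * α⁻`, where `α` is a path starting
at `x₀` and `β` is a loop, based at the end point of `α`, of diameter less than `d`. -/
noncomputable def diamPiOne (x₀ : X) (d : ℝ) : Subgroup (FundamentalGroup X x₀) :=
  Subgroup.closure {γ | ∃ (x : X) (α : Path x₀ x) (β : Path x x),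
    Metric.diam (Set.range β) < d ∧
      γ = FundamentalGroup.fromPath (Path.Homotopic.Quotient.mk ((α.trans β).trans α.symm))}

theorem diamPiOne_mono (x₀ : X) {c d : ℝ} (h : c ≤ d) : diamPiOne x₀ c ≤ diamPiOne x₀ d := by
  apply Subgroup.closure_mono
  rintro γ ⟨x, α, β, hβ, rfl⟩
  exact ⟨x, α, β, lt_of_lt_of_le hβ h, rfl⟩

instance diamPiOne_normal (x₀ : X) (d : ℝ) : (diamPiOne x₀ d).Normal := by
  have key : ∀ (x : X) (α : Path x₀ x) (β : Path x x), Metric.diam (Set.range β) < d →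
      ∀ g : FundamentalGroup X x₀, g * FundamentalGroup.fromPath
        (Path.Homotopic.Quotient.mk ((α.trans β).trans α.symm)) * g⁻¹ ∈ diamPiOne x₀ d := by
    intro x α β hβ g
    obtain ⟨δ, hδ⟩ := Path.Homotopic.Quotient.mk_surjective
      (FundamentalGroup.toPath (g⁻¹))
    have hg : (g : Path.Homotopic.Quotient x₀ x₀) =
        (Path.Homotopic.Quotient.mk δ).symm := by
      rw [hδ]
      exact (inv_inv g).symm
    refine Subgroup.subset_closure ⟨x, δ.trans α, β, hβ, ?_⟩
    rw [FundamentalGroup.mul_def, FundamentalGroup.mul_def]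
    change Path.Homotopic.Quotient.trans (FundamentalGroup.toPath (g⁻¹)) _ = _
    rw [← hδ, hg]
    simp only [FundamentalGroup.fromPath, FundamentalGroup.fromArrow, Path.trans_symm,
      Path.Homotopic.Quotient.mk_trans, Path.Homotopic.Quotient.mk_symm,
      Path.Homotopic.Quotient.trans_assoc]
  constructor
  intro n hn g
  induction hn using Subgroup.closure_induction with
  | mem γ hγ =>
    obtain ⟨x, α, β, hβ, rfl⟩ := hγ
    exact key x α β hβ g
  | one => simpa using (diamPiOne x₀ d).one_mem
  | mul a b _ _ iha ihb =>
    have := (diamPiOne x₀ d).mul_mem iha ihb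
    rwa [conj_mul] at this
  | inv a _ iha =>
    have := (diamPiOne x₀ d).inv_mem iha
    rwa [conj_inv] at this

/-- The projection `π₁(X, x₀) / D(c) → π₁(X, x₀) / D(d)` for `c ≤ d`. -/
noncomputable def diamPiOneProj (x₀ : X) {c d : ℝ} (h : c ≤ d) :
    FundamentalGroup X x₀ ⧸ diamPiOne x₀ c →* FundamentalGroup X x₀ ⧸ diamPiOne x₀ d :=
  QuotientGroup.map _ _ (MonoidHom.id _) (diamPiOne_mono x₀ h)

end PiOne

section HOne

open scoped Simplicial

/-- The first singular homology group of a space with coefficients in an abelian group. -/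
noncomputable abbrev HOne (G : Type u) [AddCommGroup G] (Y : Type u) [TopologicalSpace Y] :
    AddCommGrpCat.{u} :=
  ((singularHomologyFunctor AddCommGrpCat.{u} 1).obj (AddCommGrpCat.of G)).obj (TopCat.of Y)

/-- The homomorphism in first homology induced by a continuous map. -/
noncomputable def hOneMap (G : Type u) [AddCommGroup G] {Y Z : Type u} [TopologicalSpace Y]
    [TopologicalSpace Z] (f : C(Y, Z)) : HOne G Y →+ HOne G Z :=
  (((singularHomologyFunctor AddCommGrpCat.{u} 1).obj (AddCommGrpCat.of G)).map
    (TopCat.ofHom f)).hom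

variable {X : Type u} [TopologicalSpace X]

/-- A path, regarded as a singular 1-simplex. -/
noncomputable def pathSimplex {x y : X} (β : Path x y) : (TopCat.toSSet.obj (TopCat.of X)) _⦋1⦌ :=
  (TopCat.toSSetObjEquiv (TopCat.of X) (Opposite.op ⦋1⦌)).symm
    (β.toContinuousMap.comp ⟨stdSimplexHomeomorphUnitInterval,
      stdSimplexHomeomorphUnitInterval.continuous⟩)

theorem delta_pathSimplex {x : X} (β : Path x x) (i : Fin 2) :
    (TopCat.toSSet.obj (TopCat.of X)).δ i (pathSimplex β) = TopCat.toSSetObj₀Equiv.symm x := by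
  apply TopCat.toSSetObj₀Equiv.injective
  rw [Equiv.apply_symm_apply]
  have h : TopCat.toSSetObj₀Equiv ((TopCat.toSSet.obj (TopCat.of X)).δ i (pathSimplex β)) =
      β (stdSimplexHomeomorphUnitInterval
        (stdSimplex.map i.succAbove (stdSimplex.vertex (0 : Fin 1)))) := by
    rw [← Subsingleton.elim (default : stdSimplex ℝ (Fin 1)) (stdSimplex.vertex 0)]
    rfl
  rw [h, stdSimplex.map_vertex]
  fin_cases i
  · exact β.target
  · exact β.source

/-- For a loop `β`, the 1-chains `g • β` are cycles. -/
theorem loop_isCycle (G : Type u) [AddCommGroup G] {x : X} (β : Path x x) :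
    SSet.ιChainComplex (TopCat.toSSet.obj (TopCat.of X)) (R := AddCommGrpCat.of G) (pathSimplex β) ≫
      (((singularChainComplexFunctor AddCommGrpCat.{u}).obj (AddCommGrpCat.of G)).obj
        (TopCat.of X)).d 1 0 = 0 := by
  refine (SSet.ιChainComplex_d (TopCat.toSSet.obj (TopCat.of X)) (AddCommGrpCat.of G)
    (n := 0) (pathSimplex β)).trans ?_
  simp [Fin.sum_univ_two, delta_pathSimplex]
  rfl

/-- The homomorphism `G → H₁(X; G)` that sends `g` to the homology class of the cycle `g • β`. -/
noncomputable def loopClass (G : Type u) [AddCommGroup G] {x : X} (β : Path x x) :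
    G →+ HOne G X :=
  (HomologicalComplex.liftCycles
      (((singularChainComplexFunctor AddCommGrpCat.{u}).obj (AddCommGrpCat.of G)).obj
        (TopCat.of X))
      (SSet.ιChainComplex (TopCat.toSSet.obj (TopCat.of X)) (R := AddCommGrpCat.of G)
        (pathSimplex β)) 0 (by simp) (loop_isCycle G β) ≫
    HomologicalComplex.homologyπ _ 1).hom

end HOne

section DiamHOne

variable (X : Type u) [MetricSpace X] (G : Type u) [AddCommGroup G]

/-- The subgroup of `H₁(X; G)` generated by the classes of the cycles `g • β`, where `g ∈ G` and
`β` is a loop in `X` of diameter less than `d`. -/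
noncomputable def diamHOne (d : ℝ) : AddSubgroup (HOne G X) :=
  AddSubgroup.closure {c | ∃ (x : X) (β : Path x x) (g : G),
    Metric.diam (Set.range β) < d ∧ c = loopClass G β g}

theorem diamHOne_mono {c d : ℝ} (h : c ≤ d) : diamHOne X G c ≤ diamHOne X G d := by
  apply AddSubgroup.closure_mono
  rintro γ ⟨x, β, g, hβ, rfl⟩
  exact ⟨x, β, g, lt_of_lt_of_le hβ h, rfl⟩

/-- The projection `H₁(X; G) / D(c) → H₁(X; G) / D(d)` for `c ≤ d`. -/
noncomputable def diamHOneProj {c d : ℝ} (h : c ≤ d) :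
    HOne G X ⧸ diamHOne X G c →+ HOne G X ⧸ diamHOne X G d :=
  QuotientAddGroup.map _ _ (AddMonoidHom.id _) (diamHOne_mono X G h)

end DiamHOne

theorem scale_mono {p q : Set.Ioi (0 : ℝ)} (h : p ≤ q) : 3 * p.1 / 2 ≤ 3 * q.1 / 2 := by
  have h' : p.1 ≤ q.1 := h
  linarith

end RipsPersistence

namespace RipsPersistence

open CategoryTheory AlgebraicTopology

/-- The homotopy class of a path. -/
local notation "cls" => Path.Homotopic.Quotient.mk

/-- The unit interval. -/
local notation "I" => unitInterval

section PathClasses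

open Path.Homotopic (Quotient)

variable {Y : Type*} [TopologicalSpace Y]

/-- A property of homotopy classes of paths that holds for the paths inside the members of an open
cover and is closed under concatenation holds for all homotopy classes. -/
theorem path_induction {ι : Type*} (U : ι → Set Y) (hU : ∀ i, IsOpen (U i))
    (hcov : ∀ y, ∃ i, y ∈ U i) (P : ∀ {x y : Y}, Quotient x y → Prop)
    (small : ∀ {x y : Y} (p : Path x y) (i : ι), Set.range p ⊆ U i → P (cls p))
    (trans : ∀ {x y z : Y} (p : Quotient x y) (q : Quotient y z), P p → P q → P (p.trans q))
    {x y : Y} (p : Quotient x y) : P p := by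
  obtain ⟨γ, rfl⟩ := Path.Homotopic.Quotient.mk_surjective p
  obtain ⟨t, ht0, htm, ⟨n, hn⟩, hi⟩ := exists_monotone_Icc_subset_open_cover_unitInterval
    (c := fun i => γ ⁻¹' U i) (fun i => (hU i).preimage γ.continuous)
    (fun s _ => Set.mem_iUnion.2 (hcov (γ s)))
  have key : ∀ m, P (cls (γ.subpath 0 (t m))) := by
    intro m
    induction m with
    | zero =>
      obtain ⟨i, h⟩ := hcov (γ 0)
      refine small _ i ?_
      rw [ht0, Path.range_subpath]
      rintro _ ⟨s, hs, rfl⟩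
      obtain rfl : s = 0 := by simpa using hs
      exact h
    | succ m ih =>
      obtain ⟨i, h⟩ := hi m
      have hs := small (γ.subpath (t m) (t (m + 1))) i (by
        rw [Path.range_subpath_of_le _ _ _ (htm m.le_succ)]
        exact Set.image_subset_iff.2 h)
      have := trans _ _ ih hs
      rwa [← Quotient.mk_trans,
        Path.Homotopic.Quotient.eq.2 ⟨Path.Homotopy.subpathTransSubpath γ _ _ _⟩] at this
  have hcast : ∀ {x' y' : Y} (hx : x' = x) (hy : y' = y),
      P (cls (γ.cast hx hy)) → P (cls γ) := by
    rintro _ _ rfl rfl h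
    exact h
  have := key n
  rw [hn n le_rfl, Path.subpath_zero_one] at this
  exact hcast _ _ this

theorem symm_eq_of_trans_eq_refl {x y : Y} {p : Quotient x y} {q : Quotient y x}
    (h : p.trans q = Quotient.refl x) : p.symm = q := by
  rw [← Quotient.trans_refl p.symm, ← h, ← Quotient.trans_assoc, Quotient.symm_trans,
    Quotient.refl_trans]

/-- The path `p` is the image under `f` of a path from `z` to `z'`. -/
def Lifts {Z : Type*} [TopologicalSpace Z] (f : C(Z, Y)) {x y : Y} (p : Path x y) (z z' : Z) :
    Prop :=
  ∃ q : Path z z', ∀ t, f (q t) = p t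

namespace Lifts

variable {Z : Type*} [TopologicalSpace Z] {f : C(Z, Y)} {x y w : Y} {z z' z'' : Z}

theorem symm {p : Path x y} (h : Lifts f p z z') : Lifts f p.symm z' z := by
  obtain ⟨q, hq⟩ := h
  exact ⟨q.symm, fun t => hq _⟩

theorem trans {p : Path x y} {p' : Path y w} (h : Lifts f p z z') (h' : Lifts f p' z' z'') :
    Lifts f (p.trans p') z z'' := by
  obtain ⟨q, hq⟩ := h
  obtain ⟨q', hq'⟩ := h'
  refine ⟨q.trans q', fun t => ?_⟩
  rw [Path.trans_apply, Path.trans_apply]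
  split_ifs
  · exact hq _
  · exact hq' _

/-- Paths that lift to a simply connected space with the same end points are homotopic. -/
theorem mk_eq [SimplyConnectedSpace Z] {p p' : Path x y} (h : Lifts f p z z')
    (h' : Lifts f p' z z') : cls p = cls p' := by
  obtain ⟨q, hq⟩ := h
  obtain ⟨q', hq'⟩ := h'
  obtain rfl : f z = x := by simpa using hq 0
  obtain rfl : f z' = y := by simpa using hq 1
  have h1 : p = q.map f.continuous := Path.ext (funext fun t => (hq t).symm)
  have h2 : p' = q'.map f.continuous := Path.ext (funext fun t => (hq' t).symm)
  rw [h1, h2, Quotient.mk_map, Quotient.mk_map, Subsingleton.elim (cls q) (cls q')]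

end Lifts

/-- The boundary of a square is null-homotopic. -/
theorem square_mk_eq (f : C(I × I, Y)) {a b c d : Y} {p : Path a b} {q : Path c d} {l : Path a c}
    {r : Path b d} (hp : ∀ s, f (s, 0) = p s) (hq : ∀ s, f (s, 1) = q s) (hl : ∀ t, f (0, t) = l t)
    (hr : ∀ t, f (1, t) = r t) :
    (cls p).trans (cls r) = (cls l).trans (cls q) := by
  have : ContractibleSpace I := (convex_Icc 0 1).contractibleSpace ⟨0, by simp⟩
  have hpl : Lifts f p (0, 0) (1, 0) := ⟨Path.id.prod (Path.refl 0), hp⟩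
  have hql : Lifts f q (0, 1) (1, 1) := ⟨Path.id.prod (Path.refl 1), hq⟩
  have hll : Lifts f l (0, 0) (0, 1) := ⟨(Path.refl 0).prod Path.id, hl⟩
  have hrl : Lifts f r (1, 0) (1, 1) := ⟨(Path.refl 1).prod Path.id, hr⟩
  exact (hpl.trans hrl).mk_eq (hll.trans hql)

end PathClasses

section Monodromy

open Path.Homotopic (Quotient)

variable {Y : Type*} [TopologicalSpace Y] {Γ : Type*} [Group Γ]

/-- The covering space with fibre `Γ` defined by a locally given cocycle. -/
def cocycleCore [TopologicalSpace Γ] [DiscreteTopology Γ] (U : Y → Set Y) (hU : ∀ y, IsOpen (U y))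
    (hmem : ∀ y, y ∈ U y) (w : Y → Y → Γ)
    (hw : ∀ i, ∀ x ∈ U i, ∀ y ∈ U i, ∀ z ∈ U i, w y z * w x y = w x z) :
    FiberBundleCore Y Y Γ where
  baseSet := U
  isOpen_baseSet := hU
  indexAt := id
  mem_baseSet_at := hmem
  coordChange i j y h := w y j * w i y * h
  coordChange_self i y hy h := by
    rw [hw i i (hmem i) y hy i (hmem i)]
    have := hw i i (hmem i) i (hmem i) i (hmem i)
    simp [mul_eq_right.1 this]
  continuousOn_coordChange i j := by
    have hconst : ∀ y ∈ U i ∩ U j, ∀ y' ∈ U i ∩ U j, w y' j * w i y' = w y j * w i y := by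
      rintro y ⟨hi, hj⟩ y' ⟨hi', hj'⟩
      rw [← hw i i (hmem i) y hi y' hi', ← hw j y hj y' hj' j (hmem j)]
      group
    rcases (U i ∩ U j).eq_empty_or_nonempty with h | ⟨y, hy⟩
    · simp [h]
    · refine (Continuous.continuousOn (f := fun q : Y × Γ => w y j * w i y * q.2)
        (continuous_of_discreteTopology (f := fun h : Γ => w y j * w i y * h) |>.comp
          continuous_snd)).congr ?_
      rintro ⟨y', h⟩ ⟨hy', -⟩
      simp [hconst y hy y' hy']
  coordChange_comp i j k y := by
    rintro ⟨⟨hi, hj⟩, hk⟩ h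
    have h1 := hw j y hj j (hmem j) y hj
    have h2 := hw j y hj y hj y hj
    have h3 : w y y = 1 := mul_eq_right.1 h2
    rw [h3] at h1
    calc w y k * w j y * (w y j * w i y * h) = w y k * (w j y * w y j) * w i y * h := by group
      _ = _ := by rw [h1]; group

/-- A function that is locally a cocycle with values in a group extends uniquely to a
multiplicative function on homotopy classes of paths. -/
theorem exists_monodromy (U : Y → Set Y) (hU : ∀ y, IsOpen (U y))
    (hmem : ∀ y, y ∈ U y) (w : Y → Y → Γ)
    (hw : ∀ i, ∀ x ∈ U i, ∀ y ∈ U i, ∀ z ∈ U i, w y z * w x y = w x z) :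
    ∃ W : ∀ {x y : Y}, Quotient x y → Γ,
      (∀ {x y z : Y} (p : Quotient x y) (q : Quotient y z), W (p.trans q) = W q * W p) ∧
      ∀ {x y : Y} (p : Path x y) (i : Y), Set.range p ⊆ U i → W (cls p) = w x y := by
  let _ : TopologicalSpace Γ := ⊥
  have : DiscreteTopology Γ := ⟨rfl⟩
  let Z := cocycleCore U hU hmem w hw
  have cov : IsCoveringMap (Bundle.TotalSpace.proj : Bundle.TotalSpace Γ Z.Fiber → Y) :=
    FiberBundle.isCoveringMap
  let mk : Y → Γ → Bundle.TotalSpace Γ Z.Fiber := fun x h => ⟨x, h⟩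
  let pt : ∀ x : Y, Γ → (Bundle.TotalSpace.proj ⁻¹' {x} : Set (Bundle.TotalSpace Γ Z.Fiber)) :=
    fun x h => ⟨mk x h, rfl⟩
  have pt_inj : ∀ x g h, pt x g = pt x h → g = h := by
    intro x g h e
    exact eq_of_heq (Bundle.TotalSpace.mk.inj (congrArg Subtype.val e)).2
  have small : ∀ {x y : Y} (p : Path x y) (i : Y), Set.range p ⊆ U i → ∀ h,
      cov.monodromy (cls p) (pt x h) = pt y (w x y * h) := by
    intro x y p i hp h
    have hpt : ∀ t, p t ∈ U i := fun t => hp ⟨t, rfl⟩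
    have hx : x ∈ U i := by simpa using hpt 0
    have hy : y ∈ U i := by simpa using hpt 1
    have hself : w x x = 1 := mul_eq_right.1 (hw i x hx x hx x hx)
    let q : Path (mk x h) (mk y (w x y * h)) :=
      { toFun := fun t => mk (p t) (w x (p t) * h)
        continuous_toFun := by
          have h1 : Continuous fun t =>
              (Z.localTriv i).toOpenPartialHomeomorph.symm (p t, w x i * h) := by
            refine (Z.localTriv i).toOpenPartialHomeomorph.continuousOn_symm.comp_continuous
              (by fun_prop) fun t => ?_
            exact (Z.mem_localTriv_target i _).2 (hpt t)
          refine h1.congr fun t => ?_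
          rw [Z.localTriv_symm_apply]
          have h2 : w x (p t) * h = w (p t) (p t) * w i (p t) * (w x i * h) := by
            rw [hw i i (by exact hmem i) _ (hpt t) _ (hpt t),
              ← hw i x hx i (hmem i) _ (hpt t)]
            group
          exact congrArg (Bundle.TotalSpace.mk (p t)) h2.symm
        source' := congrArg₂ mk p.source (by simp [hself])
        target' := congrArg₂ mk p.target (by simp) }
    refine cov.monodromy_eq_of_map_eq (ex := pt x h) (ey := pt y (w x y * h)) (cls q) ?_
    rw [← Quotient.mk_map]
    rfl
  have key : ∀ {x y : Y} (p : Quotient x y), ∃ g : Γ, ∀ h,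
      cov.monodromy p (pt x h) = pt y (g * h) := by
    intro x y p
    refine path_induction U hU (fun y => ⟨y, hmem y⟩)
      (fun {x y} p => ∃ g : Γ, ∀ h, cov.monodromy p (pt x h) = pt y (g * h)) ?_ ?_ p
    · intro x y p i hp
      exact ⟨w x y, small p i hp⟩
    · rintro x y z p q ⟨g, hg⟩ ⟨g', hg'⟩
      refine ⟨g' * g, fun h => ?_⟩
      rw [cov.monodromy_trans_apply, hg, hg', mul_assoc]
  choose W hW using @key
  refine ⟨@W, ?_, ?_⟩
  · intro x y z p q
    have h1 := hW (p.trans q) 1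
    rw [cov.monodromy_trans_apply, hW, hW] at h1
    simpa using (pt_inj _ _ _ h1).symm
  · intro x y p i hp
    have h1 := hW (cls p) 1
    rw [small p i hp] at h1
    simpa using (pt_inj _ _ _ h1).symm

end Monodromy

section Star

open Path.Homotopic (Quotient)

variable {V : Type u} {K L : AbstractSimplicialComplex V}

namespace Realization

theorem exists_face_eq (x : Realization K) :
    ∃ (σ : K.faces) (s : stdSimplex ℝ (σ.1 : Finset V)), face K σ s = x := by
  obtain ⟨σ, hσ, h0, h1⟩ := x.exists_face
  refine ⟨⟨σ, hσ⟩, ⟨fun v => x.coord v, fun v => x.nonneg v, ?_⟩, ?_⟩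
  · rw [← h1, Finset.sum_coe_sort σ fun v => x.coord v]
  · ext v
    by_cases hv : v ∈ σ
    · simp [face, hv]
    · simp [face, hv, h0 v hv]

theorem face_coord_of_mem (σ : K.faces) (s : stdSimplex ℝ (σ.1 : Finset V)) {v : V}
    (hv : v ∈ σ.1) : (face K σ s).coord v = s.1 ⟨v, hv⟩ := by
  simp [face, hv]

theorem face_coord_of_notMem (σ : K.faces) (s : stdSimplex ℝ (σ.1 : Finset V)) {v : V}
    (hv : v ∉ σ.1) : (face K σ s).coord v = 0 := by
  simp [face, hv]

theorem continuous_coord (v : V) : Continuous fun x : Realization K => x.coord v := by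
  rw [continuous_iff]
  intro σ
  by_cases hv : v ∈ σ.1
  · refine Continuous.congr (f := fun s : stdSimplex ℝ (σ.1 : Finset V) => s.1 ⟨v, hv⟩)
      ((continuous_apply _).comp continuous_subtype_val) fun s => (face_coord_of_mem σ s hv).symm
  · exact continuous_const.congr fun s => (face_coord_of_notMem σ s hv).symm

/-- The open star of a vertex. -/
def star (K : AbstractSimplicialComplex V) (v : V) : Set (Realization K) := {x | x.coord v ≠ 0}

theorem isOpen_star (v : V) : IsOpen (star K v) :=
  isOpen_ne.preimage (continuous_coord v)

theorem exists_coord_ne_zero (x : Realization K) : ∃ v, x.coord v ≠ 0 := by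
  by_contra! h
  obtain ⟨σ, -, -, h1⟩ := x.exists_face
  simp [h] at h1

theorem vertex_coord_self (v : V) : (vertex K v).coord v = 1 := by simp [vertex]

theorem eq_of_vertex_coord_ne_zero {v w : V} (h : (vertex K v).coord w ≠ 0) : w = v := by
  by_contra hn
  simp [vertex, hn] at h

/-- There is a face containing the support of a given point. -/
theorem exists_faces_of_coord (x : Realization K) :
    ∃ σ ∈ K.faces, ∀ v, x.coord v ≠ 0 → v ∈ σ := by
  obtain ⟨σ, hσ, h0, -⟩ := x.exists_face
  exact ⟨σ, hσ, fun v hv => by_contra fun hn => hv (h0 v hn)⟩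

/-- An interior point of a face. -/
theorem exists_barycenter {σ : Finset V} (hσ : σ ∈ K.faces) :
    ∃ x : Realization K, ∀ v, x.coord v ≠ 0 ↔ v ∈ σ := by
  classical
  have hne : σ.Nonempty := (K.isRelLowerSet_faces hσ).1
  have hc : (σ.card : ℝ) ≠ 0 := by exact_mod_cast hne.card_pos.ne'
  refine ⟨⟨fun v => if v ∈ σ then (σ.card : ℝ)⁻¹ else 0, fun v => ?_, σ, hσ, ?_, ?_⟩, ?_⟩
  · split_ifs <;> positivity
  · intro v hv
    simp [hv]
  · rw [Finset.sum_congr rfl fun v hv => if_pos hv]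
    simp [hc]
  · intro v
    simp only [ne_eq, ite_eq_right_iff, inv_eq_zero, hc, imp_false, not_not]

open Classical in
/-- The point that divides the segment from `x` to the vertex `v` in the ratio `a : 1 - a`. -/
noncomputable def toward (v : V) (x : Realization K) (a : I) (h : x.coord v = 0 → a = 0) :
    Realization K where
  coord w := (1 - a) * x.coord w + if w = v then (a : ℝ) else 0
  nonneg w := by
    have h1 := mul_nonneg (sub_nonneg.2 a.2.2) (x.nonneg w)
    have h2 := a.2.1
    split_ifs <;> linarith
  exists_face := by
    obtain ⟨σ, hσ, h0, h1⟩ := x.exists_face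
    refine ⟨σ, hσ, fun w hw => ?_, ?_⟩
    · rw [h0 w hw]
      split_ifs with hwv
      · subst hwv
        simp [h (h0 _ hw)]
      · simp
    · rw [Finset.sum_add_distrib, ← Finset.mul_sum, h1]
      by_cases hv : v ∈ σ
      · simp [hv]
      · simp [h (h0 v hv)]

theorem toward_zero (v : V) (x : Realization K) (h : x.coord v = 0 → (0 : I) = 0) :
    toward v x 0 h = x := by
  ext w
  simp [toward]

theorem toward_one (v : V) (x : Realization K) (h : x.coord v = 0 → (1 : I) = 0) :
    toward v x 1 h = vertex K v := by
  ext w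
  simp [toward, vertex]

open Classical in
/-- The point of a simplex that divides the segment from `s` to a vertex in the ratio
`a : 1 - a`. -/
noncomputable def slide {ι : Type*} [Fintype ι] (s : stdSimplex ℝ ι) (i : ι) (a : I) :
    stdSimplex ℝ ι :=
  ⟨fun w => (1 - a) * s.1 w + if w = i then (a : ℝ) else 0, fun w => by
    have h1 := mul_nonneg (sub_nonneg.2 a.2.2) (s.2.1 w)
    have h2 := a.2.1
    beta_reduce
    split_ifs <;> linarith, by
    rw [Finset.sum_add_distrib, ← Finset.mul_sum, s.2.2]
    simp⟩

theorem continuous_slide {ι T : Type*} [Fintype ι] [TopologicalSpace T] (s : T → stdSimplex ℝ ι)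
    (hs : Continuous s) (i : ι) (a : T → I) (ha : Continuous a) :
    Continuous fun t => slide (s t) i (a t) := by
  refine Continuous.subtype_mk (continuous_pi fun w => ?_) _
  have h1 : Continuous fun t => (s t).1 w :=
    (continuous_apply w).comp (continuous_subtype_val.comp hs)
  split_ifs <;> fun_prop

theorem toward_face (σ : K.faces) (s : stdSimplex ℝ (σ.1 : Finset V)) {v : V} (hv : v ∈ σ.1)
    (a : I) (h : (face K σ s).coord v = 0 → a = 0) :
    toward v (face K σ s) a h = face K σ (slide s ⟨v, hv⟩ a) := by
  ext w
  by_cases hw : w ∈ σ.1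
  · by_cases hwv : w = v
    · subst hwv
      simp [toward, face, hw, slide]
    · have : (⟨w, hw⟩ : (σ.1 : Finset V)) ≠ ⟨v, hv⟩ := fun e => hwv (congrArg Subtype.val e)
      simp [toward, face, hw, slide, hwv, this]
  · have : w ≠ v := fun e => hw (e ▸ hv)
    simp [toward, face, hw, this]

theorem continuous_toward_face {T : Type*} [TopologicalSpace T] (σ : K.faces) (v : V)
    (s : T → stdSimplex ℝ (σ.1 : Finset V)) (hs : Continuous s) (a : T → I) (ha : Continuous a)
    (h : ∀ t, (face K σ (s t)).coord v = 0 → a t = 0) :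
    Continuous fun t => toward v (face K σ (s t)) (a t) (h t) := by
  by_cases hv : v ∈ σ.1
  · exact ((continuous_face K σ).comp (continuous_slide s hs ⟨v, hv⟩ a ha)).congr fun t =>
      (toward_face σ (s t) hv (a t) (h t)).symm
  · refine ((continuous_face K σ).comp hs).congr fun t => ?_
    have h0 := h t (face_coord_of_notMem σ _ hv)
    simp only [h0]
    exact (toward_zero v _ _).symm

/-- The straight path from a point to a vertex in its support. -/
noncomputable def seg (x : Realization K) (v : V) (h : x.coord v ≠ 0) :
    Path x (vertex K v) where
  toFun t := toward v x t (fun h' => absurd h' h)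
  continuous_toFun := by
    obtain ⟨σ, s, rfl⟩ := exists_face_eq x
    exact continuous_toward_face σ v (fun _ => s) continuous_const id continuous_id _
  source' := toward_zero _ _ _
  target' := toward_one _ _ _

theorem continuous_prod_iff {Z T : Type*} [TopologicalSpace Z] [TopologicalSpace T]
    [LocallyCompactSpace T] (F : Realization K × T → Z)
    (h : ∀ σ : K.faces, Continuous fun q : stdSimplex ℝ (σ.1 : Finset V) × T =>
      F (face K σ q.1, q.2)) : Continuous F := by
  have hx : ∀ x, Continuous fun t => F (x, t) := by
    intro x
    obtain ⟨σ, s, rfl⟩ := exists_face_eq x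
    exact (h σ).comp (by fun_prop : Continuous fun t : T => (s, t))
  let c : Realization K → C(T, Z) := fun x => ⟨fun t => F (x, t), hx x⟩
  have hc : Continuous c := by
    rw [continuous_iff]
    intro σ
    exact (ContinuousMap.curry ⟨_, h σ⟩).continuous
  exact ContinuousMap.continuous_uncurry_of_continuous ⟨c, hc⟩

/-- A path inside the open star of `v` is homotopic to the concatenation of two segments. -/
theorem mk_eq_seg_of_star {x y : Realization K} (p : Path x y) (v : V)
    (hp : Set.range p ⊆ star K v) (hx : x.coord v ≠ 0) (hy : y.coord v ≠ 0) :
    cls p = (cls (seg x v hx)).trans (cls (seg y v hy)).symm := by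
  have hpos : ∀ t, 0 < (p t).coord v := fun t =>
    lt_of_le_of_ne ((p t).nonneg v) (Ne.symm (hp ⟨t, rfl⟩))
  obtain ⟨t₀, -, ht₀⟩ := isCompact_univ.exists_isMinOn (Set.univ_nonempty (α := I))
    ((continuous_coord (K := K) v).comp p.continuous).continuousOn
  set ε := (p t₀).coord v with hε
  have hεpos : 0 < ε := hpos t₀
  have hle : ∀ t, ε ≤ (p t).coord v := fun t => ht₀ (Set.mem_univ t)
  let lam : Realization K → I := fun z => ⟨min 1 (z.coord v / ε),
    le_min zero_le_one (div_nonneg (z.nonneg v) hεpos.le), min_le_left _ _⟩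
  have hlam : Continuous lam := by
    refine Continuous.subtype_mk ?_ _
    exact continuous_const.min ((continuous_coord v).div_const ε)
  have hlam0 : ∀ z : Realization K, z.coord v = 0 → lam z = 0 := fun z hz =>
    Subtype.ext (by simp [lam, hz])
  have hlam1 : ∀ t, lam (p t) = 1 := fun t =>
    Subtype.ext (min_eq_left ((one_le_div hεpos).2 (hle t)))
  let F : Realization K × I → Realization K := fun q =>
    toward v q.1 (q.2 * lam q.1) fun h => by rw [hlam0 _ h, mul_zero]
  have hF : Continuous F := by
    refine continuous_prod_iff F fun σ => ?_
    refine continuous_toward_face σ v (fun q : _ × I => q.1) continuous_fst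
      (fun q => q.2 * lam (face K σ q.1)) ?_ _
    exact continuous_snd.mul (hlam.comp ((continuous_face K σ).comp continuous_fst))
  have hF0 : ∀ z, F (z, 0) = z := fun z => by
    ext w
    simp [F, toward]
  have hF' : ∀ t s, F (p t, s) = toward v (p t) s (fun h => absurd h (hpos t).ne') := fun t s => by
    ext w
    simp [F, toward, hlam1]
  have hsq := square_mk_eq (f := ⟨fun q : I × I => F (p q.1, q.2), by fun_prop⟩) (p := p)
    (q := Path.refl (vertex K v)) (l := seg x v hx) (r := seg y v hy)
    (fun s => hF0 _) (fun s => (hF' s 1).trans (toward_one _ _ _))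
    (fun t => by
      refine (hF' 0 t).trans ?_
      simp only [Path.source]
      rfl)
    (fun t => by
      refine (hF' 1 t).trans ?_
      simp only [Path.target]
      rfl)
  rw [Path.Homotopic.Quotient.mk_refl, Quotient.trans_refl] at hsq
  rw [← hsq, Quotient.trans_assoc, Quotient.trans_symm, Quotient.trans_refl]

instance (σ : K.faces) : ContractibleSpace (stdSimplex ℝ (σ.1 : Finset V)) := by
  classical
  obtain ⟨v, hv⟩ := (K.isRelLowerSet_faces σ.2).1
  exact (convex_stdSimplex ℝ _).contractibleSpace ⟨_, single_mem_stdSimplex ℝ (⟨v, hv⟩ : σ.1)⟩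

/-- The class of the edge path between two vertices in the support of the point `x`. -/
noncomputable def edge (x : Realization K) (v w : V) (hv : x.coord v ≠ 0) (hw : x.coord w ≠ 0) :
    Quotient (vertex K v) (vertex K w) :=
  (cls (seg x v hv)).symm.trans (cls (seg x w hw))

open Classical in
theorem lifts_seg (σ : K.faces) (s : stdSimplex ℝ (σ.1 : Finset V)) (v : V)
    (h : (face K σ s).coord v ≠ 0) (hv : v ∈ σ.1) :
    Lifts ⟨face K σ, continuous_face K σ⟩ (seg (face K σ s) v h) s
      (stdSimplex.vertex ⟨v, hv⟩) := by
  refine ⟨⟨⟨fun t => slide s ⟨v, hv⟩ t, continuous_slide _ continuous_const _ _ continuous_id⟩,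
    ?_, ?_⟩, fun t => (toward_face σ s hv t fun h' => absurd h' h).symm⟩
  · ext w
    simp [slide]
  · ext w
    simp [slide, stdSimplex.vertex, Pi.single_apply]
    rfl

theorem edge_eq (x y : Realization K) (v w : V) (hv : x.coord v ≠ 0) (hw : x.coord w ≠ 0)
    (hv' : y.coord v ≠ 0) (hw' : y.coord w ≠ 0) : edge x v w hv hw = edge y v w hv' hw' := by
  classical
  suffices key : ∀ (m : Realization K) (hm : ∀ u, m.coord u ≠ 0 ↔ u ∈ ({v, w} : Finset V))
      (x : Realization K) (hv : x.coord v ≠ 0) (hw : x.coord w ≠ 0),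
      edge x v w hv hw = edge m v w ((hm v).2 (by simp)) ((hm w).2 (by simp)) by
    obtain ⟨σ, hσ, h⟩ := x.exists_faces_of_coord
    obtain ⟨m, hm⟩ := exists_barycenter (K := K) (σ := {v, w})
      ((K.isRelLowerSet_faces hσ).2 (by
        intro u hu
        rcases Finset.mem_insert.1 hu with rfl | hu
        · exact h _ hv
        · exact h _ (by rwa [Finset.mem_singleton.1 hu])) (by simp))
    rw [key m hm x, key m hm y]
  intro m hm x hv hw
  obtain ⟨σ, s, rfl⟩ := exists_face_eq x
  have hvσ : v ∈ σ.1 := by_contra fun h => hv (face_coord_of_notMem σ s h)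
  have hwσ : w ∈ σ.1 := by_contra fun h => hw (face_coord_of_notMem σ s h)
  obtain ⟨t, rfl⟩ : ∃ t, face K σ t = m := by
    have h0 : ∀ u ∉ σ.1, m.coord u = 0 := fun u hu => by
      by_contra hne
      rcases Finset.mem_insert.1 ((hm u).1 hne) with rfl | h
      · exact hu hvσ
      · exact hu (by rwa [Finset.mem_singleton.1 h])
    obtain ⟨τ, hτ, hτ0, hτ1⟩ := m.exists_face
    have hsum : ∑ u ∈ σ.1, m.coord u = 1 := by
      rw [← hτ1, Finset.sum_subset (Finset.subset_union_left (s₂ := τ)) fun u _ hu => h0 u hu,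
        Finset.sum_subset (Finset.subset_union_right (s₁ := σ.1)) fun u _ hu => hτ0 u hu]
    refine ⟨⟨fun u => m.coord u, fun u => m.nonneg u, ?_⟩, ?_⟩
    · rw [← hsum, Finset.sum_coe_sort σ.1 fun u => m.coord u]
    · ext u
      by_cases hu : u ∈ σ.1
      · simp [face, hu]
      · simp [face, hu, h0 u hu]
  have h1 := ((lifts_seg σ s v hv hvσ).symm.trans (lifts_seg σ s w hw hwσ)).mk_eq
    ((lifts_seg σ t v ((hm v).2 (by simp)) hvσ).symm.trans
      (lifts_seg σ t w ((hm w).2 (by simp)) hwσ))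
  exact h1

theorem edge_trans (x : Realization K) (u v w : V) (hu : x.coord u ≠ 0) (hv : x.coord v ≠ 0)
    (hw : x.coord w ≠ 0) : (edge x u v hu hv).trans (edge x v w hv hw) = edge x u w hu hw := by
  unfold edge
  rw [Quotient.trans_assoc, ← Quotient.trans_assoc (cls (seg x v hv)), Quotient.trans_symm,
    Quotient.refl_trans]

theorem map_edge (h : K ≤ L) (x : Realization K) (v w : V) (hv : x.coord v ≠ 0)
    (hw : x.coord w ≠ 0) :
    (edge x v w hv hw).map (incl h) = edge (incl h x) v w hv hw := by
  unfold edge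
  rw [← Quotient.mk_symm, ← Quotient.mk_trans, ← Quotient.mk_map, Path.map_trans]
  rfl

end Realization

end Star

section Cocycle

open Path.Homotopic (Quotient)

variable {V : Type u} {K : AbstractSimplicialComplex V}

namespace Realization

theorem range_seg_subset (x : Realization K) (v : V) (h : x.coord v ≠ 0) :
    Set.range (seg x v h) ⊆ star K v := by
  rintro _ ⟨t, rfl⟩
  have h0 : 0 < x.coord v := lt_of_le_of_ne (x.nonneg v) (Ne.symm h)
  have h1 := t.2.1
  have h2 := t.2.2
  have h3 : (seg x v h t).coord v = (1 - t) * x.coord v + t := by simp [seg, toward]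
  have h4 : 0 < (1 - t) * x.coord v + t := by
    rcases h1.eq_or_lt with h | h
    · rw [← h]
      simpa using h0
    · have := mul_nonneg (sub_nonneg.2 h2) h0.le
      linarith
  change (seg x v h t).coord v ≠ 0
  rw [h3]
  exact h4.ne'

/-- A simplicial 1-cocycle with values in a group extends to a multiplicative function on the
homotopy classes of paths of the realization. -/
theorem exists_cocycle_extension {Γ : Type*} [Group Γ] (g : V → V → Γ)
    (hg : ∀ (u : Realization K) (x y z : V), u.coord x ≠ 0 → u.coord y ≠ 0 → u.coord z ≠ 0 →
      g y z * g x y = g x z) :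
    ∃ W : ∀ {x y : Realization K}, Quotient x y → Γ,
      (∀ {x y z : Realization K} (p : Quotient x y) (q : Quotient y z),
        W (p.trans q) = W q * W p) ∧
      ∀ (u : Realization K) (x y : V) (hx : u.coord x ≠ 0) (hy : u.coord y ≠ 0),
        W (edge u x y hx hy) = g x y := by
  classical
  choose vt hvt using exists_coord_ne_zero (K := K)
  have hvt_vertex : ∀ v, vt (vertex K v) = v := fun v => eq_of_vertex_coord_ne_zero (hvt _)
  have g_self : ∀ v, g v v = 1 := fun v => by
    have h : (vertex K v).coord v ≠ 0 := by simp [vertex_coord_self]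
    exact mul_eq_right.1 (hg (vertex K v) v v v h h h)
  let w : Realization K → Realization K → Γ := fun x y =>
    if h : ∃ v, x.coord v ≠ 0 ∧ y.coord v ≠ 0 then g h.choose (vt y) * g (vt x) h.choose else 1
  have hw : ∀ x y v, x.coord v ≠ 0 → y.coord v ≠ 0 → w x y = g v (vt y) * g (vt x) v := by
    intro x y v hx hy
    have h : ∃ v, x.coord v ≠ 0 ∧ y.coord v ≠ 0 := ⟨v, hx, hy⟩
    simp only [w, dif_pos h]
    rw [← hg y h.choose v (vt y) h.choose_spec.2 hy (hvt y),
      ← hg x (vt x) h.choose v (hvt x) h.choose_spec.1 hx]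
    group
  obtain ⟨W, hW, hW'⟩ := exists_monodromy (Y := Realization K) (fun x => star K (vt x))
    (fun x => isOpen_star _) (fun x => hvt x) w (by
      intro i x hx y hy z hz
      rw [hw x y _ hx hy, hw y z _ hy hz, hw x z _ hx hz]
      have h := hg y (vt i) (vt y) (vt i) hy (hvt y) hy
      rw [g_self] at h
      rw [mul_assoc, ← mul_assoc _ (g (vt i) (vt y)), h, one_mul])
  refine ⟨@W, @hW, fun u x y hx hy => ?_⟩
  have hseg : ∀ v (hv : u.coord v ≠ 0), W (cls (seg u v hv)) = g (vt u) v := by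
    intro v hv
    have h := hW' (seg u v hv) (vertex K v) (by rw [hvt_vertex]; exact range_seg_subset _ _ _)
    rw [h, hw u (vertex K v) v hv (by simp [vertex_coord_self]), hvt_vertex, g_self, one_mul]
  have h1 : W (edge u x y hx hy) * W (cls (seg u x hx)) = W (cls (seg u y hy)) := by
    rw [← hW]
    congr 1
    rw [edge, ← Quotient.trans_assoc, Quotient.trans_symm, Quotient.refl_trans]
  rw [hseg, hseg, ← hg u (vt u) x y (hvt u) hx hy] at h1
  exact mul_right_cancel h1

theorem seg_vertex (v : V) (h : (vertex K v).coord v ≠ 0) :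
    seg (vertex K v) v h = Path.refl (vertex K v) := by
  classical
  ext t w
  change (1 - (t : ℝ)) * (vertex K v).coord w + (if w = v then (t : ℝ) else 0) =
    (vertex K v).coord w
  by_cases hw : w = v <;> simp [vertex, hw]

end Realization

end Cocycle

section Geodesics

open Path.Homotopic (Quotient)

variable {X : Type u} [MetricSpace X]

theorem IsGeodesicSpace.exists_path (hX : IsGeodesicSpace X) (x y : X) :
    ∃ γ : Path x y, ∀ s t, dist (γ s) (γ t) = |(s : ℝ) - t| * dist x y := by
  obtain ⟨γ, h0, h1, h⟩ := hX x y
  have hmem : ∀ t : I, (t : ℝ) * dist x y ∈ Set.Icc 0 (dist x y) := fun t =>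
    ⟨mul_nonneg t.2.1 dist_nonneg, mul_le_of_le_one_left dist_nonneg t.2.2⟩
  have hd : ∀ s t : I, dist (γ (s * dist x y)) (γ (t * dist x y)) =
      |(s : ℝ) - t| * dist x y := fun s t => by
    rw [h _ (hmem s) _ (hmem t), ← sub_mul, abs_mul, abs_of_nonneg (dist_nonneg (x := x) (y := y))]
  refine ⟨⟨⟨fun t => γ (t * dist x y), ?_⟩, by simpa using h0, by simpa using h1⟩, hd⟩
  refine LipschitzWith.continuous (K := ⟨dist x y, dist_nonneg⟩)
    (LipschitzWith.of_dist_le_mul fun s t => ?_)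
  rw [hd, mul_comm]
  rfl

/-- A geodesic path. -/
noncomputable def geod (hX : IsGeodesicSpace X) (x y : X) : Path x y := (hX.exists_path x y).choose

theorem dist_geod (hX : IsGeodesicSpace X) (x y : X) (s t : I) :
    dist (geod hX x y s) (geod hX x y t) = |(s : ℝ) - t| * dist x y :=
  (hX.exists_path x y).choose_spec s t

theorem dist_add_dist_geod (hX : IsGeodesicSpace X) {x y z : X}
    (hz : z ∈ Set.range (geod hX x y)) : dist x z + dist z y = dist x y := by
  obtain ⟨t, rfl⟩ := hz
  have h0 := dist_geod hX x y 0 t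
  have h1 := dist_geod hX x y t 1
  have ht := t.2
  simp only [Path.source, Path.target, Set.Icc.coe_zero, Set.Icc.coe_one, zero_sub, abs_neg,
    abs_of_nonneg ht.1, abs_sub_comm (t : ℝ) 1, abs_of_nonneg (sub_nonneg.2 ht.2)] at h0 h1
  rw [h0, h1]
  ring

theorem exists_range_geod_subset_ball (hX : IsGeodesicSpace X) {x y : X} {r : ℝ}
    (h : dist x y < r) : ∃ m, Set.range (geod hX x y) ⊆ Metric.ball m (r / 2) := by
  refine ⟨geod hX x y ⟨1 / 2, by norm_num, by norm_num⟩, ?_⟩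
  rintro _ ⟨t, rfl⟩
  rw [Metric.mem_ball, dist_geod]
  have h1 : |(t : ℝ) - 1 / 2| ≤ 1 / 2 := abs_le.2 ⟨by linarith [t.2.1], by linarith [t.2.2]⟩
  have h2 := mul_le_mul_of_nonneg_right h1 (dist_nonneg (x := x) (y := y))
  simp only
  linarith

theorem exists_dist_eq (hX : IsGeodesicSpace X) (x y : X) {a : ℝ} (h0 : 0 ≤ a)
    (h1 : a ≤ dist x y) : ∃ m, dist x m = a ∧ dist m y = dist x y - a := by
  obtain ⟨γ, hx, hy, h⟩ := hX x y
  refine ⟨γ a, ?_, ?_⟩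
  · have := h 0 ⟨le_rfl, dist_nonneg⟩ a ⟨h0, h1⟩
    rwa [hx, zero_sub, abs_neg, abs_of_nonneg h0] at this
  · have := h a ⟨h0, h1⟩ (dist x y) ⟨dist_nonneg, le_rfl⟩
    rwa [hy, abs_sub_comm, abs_of_nonneg (sub_nonneg.2 h1)] at this

/-- A geodesic triangle of perimeter less than `2 * d` has diameter less than `d`. -/
theorem diam_triangle_lt (hX : IsGeodesicSpace X) {x y z : X} {d : ℝ}
    (h : dist x y + dist y z + dist x z < 2 * d) :
    Metric.diam (Set.range ((geod hX x y).trans (geod hX y z)) ∪ Set.range (geod hX x z)) < d := by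
  have hxy := dist_triangle_right x y z
  have hyz := dist_triangle_left y z x
  have hxz := dist_triangle x y z
  refine lt_of_le_of_lt (Metric.diam_le_of_forall_dist_le
    (C := (dist x y + dist y z + dist x z) / 2) (by positivity) ?_) (by linarith)
  rw [Path.trans_range]
  intro P hP Q hQ
  have key : ∀ R : X, dist P Q ≤ dist P R + dist R Q := fun R => dist_triangle _ _ _
  have kx := key x
  have ky := key y
  have kz := key z
  have kxz : dist P Q ≤ dist P x + dist x z + dist z Q := dist_triangle4 _ _ _ _
  have kzx : dist P Q ≤ dist P z + dist z x + dist x Q := dist_triangle4 _ _ _ _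
  have kxy : dist P Q ≤ dist P x + dist x y + dist y Q := dist_triangle4 _ _ _ _
  have kyx : dist P Q ≤ dist P y + dist y x + dist x Q := dist_triangle4 _ _ _ _
  have kyz : dist P Q ≤ dist P y + dist y z + dist z Q := dist_triangle4 _ _ _ _
  have kzy : dist P Q ≤ dist P z + dist z y + dist y Q := dist_triangle4 _ _ _ _
  simp only [dist_comm P x, dist_comm P y, dist_comm P z, dist_comm z x,
    dist_comm z y, dist_comm y x] at *
  rcases hP with (hP | hP) | hP <;> rcases hQ with (hQ | hQ) | hQ <;>
    · have h1 := dist_add_dist_geod hX hP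
      have h2 := dist_add_dist_geod hX hQ
      simp only [dist_comm Q, dist_comm P y, dist_comm P z] at h1 h2
      linarith

end Geodesics

section RipsPoints

open Path.Homotopic (Quotient)
open Realization

variable {X : Type u} [MetricSpace X] {r : Set.Ioi (0 : ℝ)}

theorem exists_rips_point (S : Finset X) (hS : S.Nonempty)
    (h : ∀ x ∈ S, ∀ y ∈ S, dist x y < r.1) :
    ∃ u : Realization (rips X r), ∀ v ∈ S, u.coord v ≠ 0 := by
  obtain ⟨u, hu⟩ := exists_barycenter (K := rips X r) (σ := S) ⟨hS, by
    obtain ⟨⟨a, b⟩, hab, hmax⟩ := (S ×ˢ S).exists_max_image (fun q => dist q.1 q.2) (hS.product hS)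
    rw [Finset.mem_product] at hab
    refine lt_of_le_of_lt (Metric.diam_le_of_forall_dist_le dist_nonneg fun x hx y hy => ?_)
      (h a hab.1 b hab.2)
    exact hmax (x, y) (Finset.mem_product.2 ⟨hx, hy⟩)⟩
  exact ⟨u, fun v hv => (hu v).2 hv⟩

theorem exists_rips_point₃ {x y z : X} (hxy : dist x y < r.1) (hyz : dist y z < r.1)
    (hxz : dist x z < r.1) :
    ∃ u : Realization (rips X r), u.coord x ≠ 0 ∧ u.coord y ≠ 0 ∧ u.coord z ≠ 0 := by
  classical
  have h0 : (0 : ℝ) < r.1 := r.2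
  obtain ⟨u, hu⟩ := exists_rips_point (r := r) {x, y, z} (by simp) (by
    intro a ha b hb
    simp only [Finset.mem_insert, Finset.mem_singleton] at ha hb
    rcases ha with rfl | rfl | rfl <;> rcases hb with rfl | rfl | rfl <;>
      simp_all [dist_comm])
  exact ⟨u, hu _ (by simp), hu _ (by simp), hu _ (by simp)⟩

theorem exists_rips_point₂ {x y : X} (hxy : dist x y < r.1) :
    ∃ u : Realization (rips X r), u.coord x ≠ 0 ∧ u.coord y ≠ 0 := by
  obtain ⟨u, hx, -, hy⟩ := exists_rips_point₃ (r := r) (x := x) (y := x) (z := y)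
    (by rw [dist_self]; exact r.2) hxy hxy
  exact ⟨u, hx, hy⟩

theorem dist_lt_of_coord (u : Realization (rips X r)) {x y : X} (hx : u.coord x ≠ 0)
    (hy : u.coord y ≠ 0) : dist x y < r.1 := by
  obtain ⟨σ, hσ, h⟩ := u.exists_faces_of_coord
  exact lt_of_le_of_lt (Metric.dist_le_diam_of_mem σ.finite_toSet.isBounded (h x hx) (h y hy)) hσ.2

theorem dist_lt_of_mem_ball {m x y : X} {s : ℝ} (hx : x ∈ Metric.ball m (s / 2))
    (hy : y ∈ Metric.ball m (s / 2)) : dist x y < s := by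
  have := dist_triangle_right x y m
  rw [Metric.mem_ball] at hx hy
  linarith

theorem nonempty_rips_path (hX : IsGeodesicSpace X) (x y : X) :
    Nonempty (Quotient (vertex (rips X r) x) (vertex (rips X r) y)) := by
  have h0 : (0 : ℝ) < r.1 := r.2
  refine path_induction (fun m : X => Metric.ball m (r.1 / 2)) (fun m => Metric.isOpen_ball)
    (fun m => ⟨m, Metric.mem_ball_self (by positivity)⟩)
    (fun {x y} _ => Nonempty (Quotient (vertex (rips X r) x) (vertex (rips X r) y))) ?_ ?_
    (cls (geod hX x y))
  · intro x y p m hp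
    obtain ⟨u, hx, hy⟩ := exists_rips_point₂ (r := r)
      (dist_lt_of_mem_ball (hp p.source_mem_range) (hp p.target_mem_range))
    exact ⟨edge u x y hx hy⟩
  · rintro x y z - - ⟨p⟩ ⟨q⟩
    exact ⟨p.trans q⟩

/-- There is a functor from the fundamental groupoid of `X` to that of the Rips complex that sends
short paths to edges. -/
theorem exists_ripsMap (hX : IsGeodesicSpace X) (r : Set.Ioi (0 : ℝ)) :
    ∃ ψ : ∀ {x y : X}, Quotient x y → Quotient (vertex (rips X r) x) (vertex (rips X r) y),
      (∀ {x y z : X} (p : Quotient x y) (q : Quotient y z),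
        ψ (p.trans q) = (ψ p).trans (ψ q)) ∧
      ∀ {x y : X} (p : Path x y) (m : X), Set.range p ⊆ Metric.ball m (r.1 / 2) →
        ∀ (u : Realization (rips X r)) (hx : u.coord x ≠ 0) (hy : u.coord y ≠ 0),
          ψ (cls p) = edge u x y hx hy := by
  classical
  rcases isEmpty_or_nonempty X with hE | ⟨⟨x₀⟩⟩
  · exact ⟨fun {x} => hE.elim x, fun {x} => hE.elim x, fun {x} => hE.elim x⟩
  have h0 : (0 : ℝ) < r.1 := r.2
  have e : ∀ x, Quotient (vertex (rips X r) x₀) (vertex (rips X r) x) := fun x =>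
    (nonempty_rips_path hX x₀ x).some
  let w : X → X → FundamentalGroup (Realization (rips X r)) (vertex (rips X r) x₀) := fun x y =>
    if h : ∃ u : Realization (rips X r), u.coord x ≠ 0 ∧ u.coord y ≠ 0 then
      FundamentalGroup.fromPath
        ((e x).trans ((edge h.choose x y h.choose_spec.1 h.choose_spec.2).trans (e y).symm))
    else 1
  have hw : ∀ x y (u : Realization (rips X r)) (hx : u.coord x ≠ 0) (hy : u.coord y ≠ 0),
      w x y = FundamentalGroup.fromPath ((e x).trans ((edge u x y hx hy).trans (e y).symm)) := by
    intro x y u hx hy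
    have h : ∃ u : Realization (rips X r), u.coord x ≠ 0 ∧ u.coord y ≠ 0 := ⟨u, hx, hy⟩
    simp only [w, dif_pos h]
    rw [edge_eq h.choose u]
  obtain ⟨W, hW, hW'⟩ := exists_monodromy (Y := X) (fun m => Metric.ball m (r.1 / 2))
    (fun m => Metric.isOpen_ball) (fun m => Metric.mem_ball_self (by positivity)) w (by
      intro i x hx y hy z hz
      obtain ⟨u, ux, uy, uz⟩ := exists_rips_point₃ (r := r) (dist_lt_of_mem_ball hx hy)
        (dist_lt_of_mem_ball hy hz) (dist_lt_of_mem_ball hx hz)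
      rw [hw x y u ux uy, hw y z u uy uz, hw x z u ux uz, ← edge_trans u x y z ux uy uz,
        FundamentalGroup.mul_def]
      change Quotient.trans _ _ = _
      simp only [FundamentalGroup.fromPath, FundamentalGroup.fromArrow, Quotient.trans_assoc]
      rw [← Quotient.trans_assoc (e y).symm, Quotient.symm_trans, Quotient.refl_trans])
  refine ⟨fun {x y} p => (e x).symm.trans
    ((FundamentalGroup.toPath (W p)).trans (e y)), ?_, ?_⟩
  · intro x y z p q
    beta_reduce
    rw [hW, FundamentalGroup.mul_def]
    change Quotient.trans _ (Quotient.trans (Quotient.trans _ _) _) = _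
    simp only [FundamentalGroup.toPath, FundamentalGroup.toArrow, Quotient.trans_assoc]
    rw [← Quotient.trans_assoc (e y), Quotient.trans_symm, Quotient.refl_trans]
  · intro x y p m hp u hx hy
    beta_reduce
    rw [hW' p m hp, hw x y u hx hy]
    simp only [FundamentalGroup.toPath, FundamentalGroup.toArrow, FundamentalGroup.fromPath,
      FundamentalGroup.fromArrow, Quotient.trans_assoc]
    rw [Quotient.symm_trans, Quotient.trans_refl, ← Quotient.trans_assoc, Quotient.symm_trans,
      Quotient.refl_trans]

/-- The functor from the fundamental groupoid of `X` to that of the Rips complex. -/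
noncomputable def ripsMap (hX : IsGeodesicSpace X) (r : Set.Ioi (0 : ℝ)) {x y : X}
    (p : Quotient x y) : Quotient (vertex (rips X r) x) (vertex (rips X r) y) :=
  (exists_ripsMap hX r).choose p

theorem ripsMap_trans (hX : IsGeodesicSpace X) {x y z : X} (p : Quotient x y)
    (q : Quotient y z) : ripsMap hX r (p.trans q) = (ripsMap hX r p).trans (ripsMap hX r q) :=
  (exists_ripsMap hX r).choose_spec.1 p q

theorem ripsMap_of_subset_ball (hX : IsGeodesicSpace X) {x y : X} (p : Path x y) (m : X)
    (hp : Set.range p ⊆ Metric.ball m (r.1 / 2)) (u : Realization (rips X r))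
    (hx : u.coord x ≠ 0) (hy : u.coord y ≠ 0) : ripsMap hX r (cls p) = edge u x y hx hy :=
  (exists_ripsMap hX r).choose_spec.2 p m hp u hx hy

theorem ripsMap_refl (hX : IsGeodesicSpace X) (x : X) :
    ripsMap hX r (Quotient.refl x) = Quotient.refl _ := by
  have h := ripsMap_trans (r := r) hX (Quotient.refl x) (Quotient.refl x)
  rw [Quotient.trans_refl] at h
  rw [← Quotient.trans_symm (ripsMap hX r (Quotient.refl x))]
  nth_rw 2 [h]
  rw [Quotient.trans_assoc, Quotient.trans_symm, Quotient.trans_refl]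

theorem ripsMap_symm (hX : IsGeodesicSpace X) {x y : X} (p : Quotient x y) :
    ripsMap hX r p.symm = (ripsMap hX r p).symm := by
  refine (symm_eq_of_trans_eq_refl ?_).symm
  rw [← ripsMap_trans, Quotient.trans_symm, ripsMap_refl]

theorem ripsMap_geod (hX : IsGeodesicSpace X) {x y : X} (u : Realization (rips X r))
    (hx : u.coord x ≠ 0) (hy : u.coord y ≠ 0) :
    ripsMap hX r (cls (geod hX x y)) = edge u x y hx hy := by
  obtain ⟨m, hm⟩ := exists_range_geod_subset_ball hX (dist_lt_of_coord u hx hy)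
  exact ripsMap_of_subset_ball hX _ m hm u hx hy

end RipsPoints

section PiOneRips

open Path.Homotopic (Quotient)
open Realization

variable {X : Type u} [MetricSpace X] {r : Set.Ioi (0 : ℝ)}

/-- A loop of diameter less than `3 * r / 2` is trivial in the Rips complex. -/
theorem ripsMap_eq_refl_of_diam_lt (hX : IsGeodesicSpace X) {z : X} (β : Path z z)
    (hβ : Metric.diam (Set.range β) < 3 * r.1 / 2) :
    ripsMap hX r (cls β) = Quotient.refl _ := by
  have h0 : (0 : ℝ) < r.1 := r.2
  have hdist : ∀ t, dist z (β t) ≤ Metric.diam (Set.range β) := fun t =>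
    Metric.dist_le_diam_of_mem (isCompact_range β.continuous).isBounded β.source_mem_range ⟨t, rfl⟩
  set D := max (Metric.diam (Set.range β)) r.1 with hD
  have hDr : r.1 ≤ D := le_max_right _ _
  have hDlt : D < 3 * r.1 / 2 := max_lt hβ (by linarith)
  have hdD : ∀ t, dist z (β t) ≤ D := fun t => (hdist t).trans (le_max_left _ _)
  obtain ⟨κ, hκ⟩ : ∃ κ, κ = (D - r.1 / 2) / 2 := ⟨_, rfl⟩
  have hmid : ∀ x, dist z x ≤ D → ∃ m, dist z m < r.1 ∧ dist m x ≤ κ := by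
    intro x hx
    obtain ⟨m, h1, h2⟩ := exists_dist_eq hX z x (a := min (dist z x) (D - κ))
      (le_min dist_nonneg (by linarith)) (min_le_left _ _)
    refine ⟨m, ?_, ?_⟩
    · rw [h1]
      exact lt_of_le_of_lt (min_le_right _ _) (by linarith)
    · rw [h2]
      rcases min_cases (dist z x) (D - κ) with ⟨h, -⟩ | ⟨h, -⟩ <;> rw [h] <;> linarith
  have hE : ∀ x, ∃ E : Quotient (vertex (rips X r) z) (vertex (rips X r) x), dist z x ≤ D →
      ∃ m, dist z m < r.1 ∧ dist m x ≤ κ ∧ ∀ (u u' : Realization (rips X r))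
        (hz : u.coord z ≠ 0) (hm : u.coord m ≠ 0) (hm' : u'.coord m ≠ 0) (hx : u'.coord x ≠ 0),
          E = (edge u z m hz hm).trans (edge u' m x hm' hx) := by
    intro x
    by_cases hx : dist z x ≤ D
    · obtain ⟨m, hm, hm'⟩ := hmid x hx
      obtain ⟨u, uz, um⟩ := exists_rips_point₂ (r := r) hm
      obtain ⟨u', um', ux⟩ := exists_rips_point₂ (r := r) (x := m) (y := x) (by linarith)
      refine ⟨(edge u z m uz um).trans (edge u' m x um' ux), fun _ => ⟨m, hm, hm', ?_⟩⟩
      intro v v' hz h1 h2 h3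
      rw [edge_eq u v, edge_eq u' v']
    · exact ⟨(nonempty_rips_path hX z x).some, fun h => absurd h hx⟩
  choose E hE using hE
  have key : ∀ {s t : I} (p : Quotient s t), ripsMap hX r (p.map β.toContinuousMap) =
      (E (β s)).symm.trans (E (β t)) := by
    intro s t p
    refine path_induction (fun m : X => β ⁻¹' Metric.ball m ((r.1 - 2 * κ) / 2))
      (fun m => Metric.isOpen_ball.preimage β.continuous)
      (fun t => ⟨β t, Metric.mem_ball_self (by linarith)⟩)
      (fun {s t} p => ripsMap hX r (p.map β.toContinuousMap) = (E (β s)).symm.trans (E (β t)))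
      ?_ ?_ p
    · intro s t p m hp
      have hs : β s ∈ Metric.ball m ((r.1 - 2 * κ) / 2) := hp p.source_mem_range
      have ht : β t ∈ Metric.ball m ((r.1 - 2 * κ) / 2) := hp p.target_mem_range
      have hst := dist_lt_of_mem_ball hs ht
      obtain ⟨a, hza, has, hEa⟩ := hE (β s) (hdD s)
      obtain ⟨b, hzb, hbt, hEb⟩ := hE (β t) (hdD t)
      have hsb : dist (β s) b ≤ dist (β s) (β t) + dist b (β t) := dist_triangle_right _ _ _
      have hab : dist a b ≤ dist a (β s) + dist (β s) b := dist_triangle _ _ _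
      have hat : dist a (β t) ≤ dist a (β s) + dist (β s) (β t) := dist_triangle _ _ _
      obtain ⟨u₁, u₁z, u₁a, u₁b⟩ := exists_rips_point₃ (r := r) hza (by linarith : dist a b < r.1)
        hzb
      obtain ⟨u₂, u₂a, u₂b, u₂t⟩ := exists_rips_point₃ (r := r) (by linarith : dist a b < r.1)
        (by linarith : dist b (β t) < r.1) (by linarith : dist a (β t) < r.1)
      obtain ⟨u₃, u₃a, u₃s, u₃t⟩ := exists_rips_point₃ (r := r) (by linarith : dist a (β s) < r.1)
        (by linarith : dist (β s) (β t) < r.1) (by linarith : dist a (β t) < r.1)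
      have h1 : ripsMap hX r ((cls p).map β.toContinuousMap) = edge u₃ (β s) (β t) u₃s u₃t := by
        rw [← Quotient.mk_map]
        refine ripsMap_of_subset_ball hX _ m ?_ _ _ _
        rintro _ ⟨v, rfl⟩
        exact Metric.ball_subset_ball (by linarith) (hp ⟨v, rfl⟩)
      rw [h1, hEa u₁ u₃ u₁z u₁a u₃a u₃s, hEb u₁ u₂ u₁z u₁b u₂b u₂t,
        ← edge_trans u₁ z a b u₁z u₁a u₁b,
        Quotient.trans_assoc, edge_eq u₁ u₂ a b u₁a u₁b u₂a u₂b, edge_trans, edge_eq u₂ u₃ a (β t)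
        u₂a u₂t u₃a u₃t, ← edge_trans u₃ a (β s) (β t) u₃a u₃s u₃t,
        ← Quotient.trans_assoc (edge u₁ z a u₁z u₁a), ← Quotient.trans_assoc, Quotient.symm_trans,
        Quotient.refl_trans]
    · intro s t v p q hp hq
      have hmap : (p.trans q).map β.toContinuousMap =
          (p.map β.toContinuousMap).trans (q.map β.toContinuousMap) := by
        induction p using Path.Homotopic.Quotient.ind with | mk p =>
        induction q using Path.Homotopic.Quotient.ind with | mk q =>
        rw [← Quotient.mk_trans, ← Quotient.mk_map, Path.map_trans]
        rfl
      rw [hmap, ripsMap_trans, hp, hq, Quotient.trans_assoc,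
        ← Quotient.trans_assoc (E (β t)), Quotient.trans_symm, Quotient.refl_trans]
  have hcast : ∀ {a b : X} (ha : z = a) (hb : z = b) (p : Path a b),
      ripsMap hX r (cls p) = (E a).symm.trans (E b) →
        ripsMap hX r (cls (p.cast ha hb)) = Quotient.refl _ := by
    rintro _ _ rfl rfl p hp
    rw [Path.cast_rfl_rfl, hp, Quotient.symm_trans]
  have h := hcast β.source.symm β.target.symm _ (key (cls Path.id))
  exact h

/-- The homomorphism from the fundamental group of `X` to that of the Rips complex. -/
noncomputable def piOneRips (hX : IsGeodesicSpace X) (r : Set.Ioi (0 : ℝ)) (x₀ : X) :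
    FundamentalGroup X x₀ →* FundamentalGroup (Realization (rips X r)) (vertex (rips X r) x₀) where
  toFun γ := FundamentalGroup.fromPath (ripsMap hX r (FundamentalGroup.toPath γ))
  map_one' := ripsMap_refl hX x₀
  map_mul' _ _ := ripsMap_trans hX _ _

theorem diamPiOne_le_ker (hX : IsGeodesicSpace X) (x₀ : X) :
    diamPiOne x₀ (3 * r.1 / 2) ≤ (piOneRips hX r x₀).ker := by
  refine (Subgroup.closure_le _).2 ?_
  rintro _ ⟨x, α, β, hβ, rfl⟩
  change ripsMap hX r (cls ((α.trans β).trans α.symm)) = Quotient.refl _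
  rw [Quotient.mk_trans, Quotient.mk_trans, Quotient.mk_symm, ripsMap_trans, ripsMap_trans,
    ripsMap_eq_refl_of_diam_lt hX β hβ, ripsMap_symm, Quotient.trans_refl, Quotient.trans_symm]

theorem exists_ripsMap_eq (hX : IsGeodesicSpace X) {u u' : Realization (rips X r)}
    (p : Quotient u u') (a b : X) (ha : u.coord a ≠ 0) (hb : u'.coord b ≠ 0) :
    ∃ q : Quotient a b,
      (cls (seg u a ha)).symm.trans (p.trans (cls (seg u' b hb))) = ripsMap hX r q := by
  refine path_induction (fun v : X => star (rips X r) v) (fun v => isOpen_star v)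
    exists_coord_ne_zero (fun {u u'} p => ∀ (a b : X) (ha : u.coord a ≠ 0) (hb : u'.coord b ≠ 0),
      ∃ q : Quotient a b,
        (cls (seg u a ha)).symm.trans (p.trans (cls (seg u' b hb))) = ripsMap hX r q)
    ?_ ?_ p a b ha hb
  · intro u u' p v hp a b ha hb
    have hu : u.coord v ≠ 0 := hp p.source_mem_range
    have hu' : u'.coord v ≠ 0 := hp p.target_mem_range
    refine ⟨(cls (geod hX a v)).trans (cls (geod hX v b)), ?_⟩
    rw [ripsMap_trans, ripsMap_geod hX u ha hu, ripsMap_geod hX u' hu' hb,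
      mk_eq_seg_of_star p v hp hu hu', edge, edge]
    simp only [Quotient.trans_assoc]
  · intro u u' u'' p p' hp hp' a b ha hb
    obtain ⟨c, hc⟩ := exists_coord_ne_zero u'
    obtain ⟨q, hq⟩ := hp a c ha hc
    obtain ⟨q', hq'⟩ := hp' c b hc hb
    refine ⟨q.trans q', ?_⟩
    rw [ripsMap_trans, ← hq, ← hq']
    simp only [Quotient.trans_assoc]
    rw [← Quotient.trans_assoc (cls (seg u' c hc)), Quotient.trans_symm, Quotient.refl_trans]

theorem piOneRips_surjective (hX : IsGeodesicSpace X) (x₀ : X) :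
    Function.Surjective (piOneRips hX r x₀) := by
  intro γ
  have h : (vertex (rips X r) x₀).coord x₀ ≠ 0 := by simp [vertex_coord_self]
  obtain ⟨q, hq⟩ := exists_ripsMap_eq hX (FundamentalGroup.toPath γ) x₀ x₀ h h
  refine ⟨FundamentalGroup.fromPath q, hq.symm.trans ?_⟩
  rw [seg_vertex, Path.Homotopic.Quotient.mk_refl, Quotient.trans_refl]
  have : (Quotient.refl (vertex (rips X r) x₀)).symm = Quotient.refl _ := rfl
  rw [this, Quotient.refl_trans]

theorem ker_piOneRips_le (hX : IsGeodesicSpace X) (x₀ : X) :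
    (piOneRips hX r x₀).ker ≤ diamPiOne x₀ (3 * r.1 / 2) := by
  have h0 : (0 : ℝ) < r.1 := r.2
  obtain ⟨c, hc⟩ : ∃ c : ∀ x, Quotient x₀ x, c x₀ = Quotient.refl x₀ :=
    ⟨fun x => (cls (geod hX x₀ x₀)).symm.trans (cls (geod hX x₀ x)), Quotient.symm_trans _⟩
  let lp : ∀ {x y : X}, Quotient x y → FundamentalGroup X x₀ ⧸ diamPiOne x₀ (3 * r.1 / 2) :=
    fun {x y} p => QuotientGroup.mk (FundamentalGroup.fromPath ((c x).trans (p.trans (c y).symm)))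
  have lp_trans : ∀ {x y z : X} (p : Quotient x y) (q : Quotient y z),
      lp (p.trans q) = lp q * lp p := by
    intro x y z p q
    simp only [lp]
    rw [← QuotientGroup.mk_mul, FundamentalGroup.mul_def]
    congr 1
    change _ = Quotient.trans _ _
    simp only [FundamentalGroup.fromPath, FundamentalGroup.fromArrow, Quotient.trans_assoc]
    rw [← Quotient.trans_assoc (c y).symm, Quotient.symm_trans, Quotient.refl_trans]
  have lp_eq : ∀ {x y : X} (p q : Path x y),
      Metric.diam (Set.range p ∪ Set.range q) < 3 * r.1 / 2 → lp (cls p) = lp (cls q) := by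
    intro x y p q hpq
    refine QuotientGroup.eq.2 ?_
    obtain ⟨α, hα⟩ := Path.Homotopic.Quotient.mk_surjective (c x)
    refine Subgroup.subset_closure ⟨x, α, q.trans p.symm, ?_, ?_⟩
    · rwa [Path.trans_range, Path.symm_range, Set.union_comm]
    · rw [FundamentalGroup.mul_def, FundamentalGroup.inv_def]
      change Quotient.trans _ (Quotient.symm _) = _
      simp only [FundamentalGroup.fromPath, FundamentalGroup.fromArrow, Quotient.mk_trans,
        Quotient.mk_symm, hα]
      have hs : ((c x).trans ((cls p).trans (c y).symm)).symm =
          (c y).trans ((cls p).symm.trans (c x).symm) := by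
        refine symm_eq_of_trans_eq_refl ?_
        simp only [Quotient.trans_assoc]
        rw [← Quotient.trans_assoc (c y).symm, Quotient.symm_trans, Quotient.refl_trans,
          ← Quotient.trans_assoc (cls p), Quotient.trans_symm, Quotient.refl_trans,
          Quotient.trans_symm]
      rw [hs]
      simp only [Quotient.trans_assoc]
      rw [← Quotient.trans_assoc (c y).symm, Quotient.symm_trans, Quotient.refl_trans]
  obtain ⟨W, hW, hWedge⟩ := exists_cocycle_extension (K := rips X r)
    (fun x y => lp (cls (geod hX x y))) (by
      intro u x y z hx hy hz
      rw [← lp_trans, ← Quotient.mk_trans]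
      refine lp_eq _ _ (diam_triangle_lt hX ?_)
      have h1 := dist_lt_of_coord u hx hy
      have h2 := dist_lt_of_coord u hy hz
      have h3 := dist_lt_of_coord u hx hz
      linarith)
  have key : ∀ {x y : X} (p : Quotient x y), W (ripsMap hX r p) = lp p := by
    intro x y p
    refine path_induction (fun m : X => Metric.ball m (r.1 / 8)) (fun m => Metric.isOpen_ball)
      (fun m => ⟨m, Metric.mem_ball_self (by positivity)⟩)
      (fun {x y} p => W (ripsMap hX r p) = lp p) ?_ ?_ p
    · intro x y p m hp
      have hx := Metric.mem_ball.1 (hp p.source_mem_range)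
      have hy := Metric.mem_ball.1 (hp p.target_mem_range)
      have hxy := dist_triangle_right x y m
      obtain ⟨u, ux, uy⟩ := exists_rips_point₂ (r := r) (x := x) (y := y) (by linarith)
      rw [ripsMap_of_subset_ball hX p m (hp.trans (Metric.ball_subset_ball (by linarith))) u ux uy,
        hWedge]
      refine lp_eq _ _ (lt_of_le_of_lt (Metric.diam_mono (t := Metric.closedBall m (3 * r.1 / 8)) ?_
        Metric.isBounded_closedBall)
        (lt_of_le_of_lt (Metric.diam_closedBall (by positivity)) (by linarith)))
      refine Set.union_subset ?_
        (hp.trans (Metric.ball_subset_closedBall.trans (Metric.closedBall_subset_closedBall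
          (by linarith))))
      intro q hq
      have h1 := dist_add_dist_geod hX hq
      have h2 := dist_triangle q x m
      rw [dist_comm q x] at h2
      have h3 := dist_nonneg (x := q) (y := y)
      rw [Metric.mem_closedBall]
      linarith
    · intro x y z p q hp hq
      rw [ripsMap_trans, hW, hp, hq, lp_trans]
  have lp_self : ∀ γ : FundamentalGroup X x₀,
      lp (FundamentalGroup.toPath γ) = QuotientGroup.mk γ := by
    intro γ
    have : (Quotient.refl x₀).symm = Quotient.refl x₀ := rfl
    simp only [lp, hc, this, Quotient.trans_refl, Quotient.refl_trans]
  intro γ hγ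
  have hγ' : ripsMap hX r (FundamentalGroup.toPath γ) = ripsMap hX r (Quotient.refl x₀) :=
    (MonoidHom.mem_ker.1 hγ).trans (ripsMap_refl hX x₀).symm
  have h := key (FundamentalGroup.toPath γ)
  rw [hγ', key, lp_self] at h
  exact (QuotientGroup.eq_one_iff γ).1 ((lp_self γ).symm.trans h.symm)

theorem ker_piOneRips (hX : IsGeodesicSpace X) (x₀ : X) :
    (piOneRips hX r x₀).ker = diamPiOne x₀ (3 * r.1 / 2) :=
  le_antisymm (ker_piOneRips_le hX x₀) (diamPiOne_le_ker hX x₀)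

theorem map_incl_ripsMap (hX : IsGeodesicSpace X) {p q : Set.Ioi (0 : ℝ)} (hpq : p ≤ q) {x y : X}
    (c : Quotient x y) : (ripsMap hX p c).map (incl (rips_mono hpq)) = ripsMap hX q c := by
  have h0 : (0 : ℝ) < p.1 := p.2
  have hpq' : p.1 ≤ q.1 := hpq
  refine path_induction (fun m : X => Metric.ball m (p.1 / 2)) (fun m => Metric.isOpen_ball)
    (fun m => ⟨m, Metric.mem_ball_self (by positivity)⟩)
    (fun {x y} c => (ripsMap hX p c).map (incl (rips_mono hpq)) = ripsMap hX q c) ?_ ?_ c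
  · intro x y c m hc
    obtain ⟨u, ux, uy⟩ := exists_rips_point₂ (r := p)
      (dist_lt_of_mem_ball (hc c.source_mem_range) (hc c.target_mem_range))
    rw [ripsMap_of_subset_ball hX c m hc u ux uy, map_edge]
    exact (ripsMap_of_subset_ball hX c m (hc.trans (Metric.ball_subset_ball (by linarith)))
      (incl (rips_mono hpq) u) ux uy).symm
  · intro x y z c c' hc hc'
    rw [ripsMap_trans, ripsMap_trans, ← hc, ← hc']
    exact (FundamentalGroupoid.map (incl (rips_mono hpq))).map_comp
      (X := ⟨_⟩) (Y := ⟨_⟩) (Z := ⟨_⟩) (ripsMap hX p c) (ripsMap hX p c')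

theorem piOneIncl_piOneRips (hX : IsGeodesicSpace X) {p q : Set.Ioi (0 : ℝ)} (hpq : p ≤ q) (x₀ : X)
    (γ : FundamentalGroup X x₀) :
    piOneIncl (rips_mono hpq) x₀ (piOneRips hX p x₀ γ) = piOneRips hX q x₀ γ :=
  map_incl_ripsMap hX hpq (FundamentalGroup.toPath γ)

/-- The isomorphism from the fundamental group of the Rips complex to the quotient of the
fundamental group of `X` by the lassos of small diameter. -/
noncomputable def piOneRipsEquiv (hX : IsGeodesicSpace X) (r : Set.Ioi (0 : ℝ)) (x₀ : X) :
    FundamentalGroup (Realization (rips X r)) (vertex (rips X r) x₀) ≃*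
      FundamentalGroup X x₀ ⧸ diamPiOne x₀ (3 * r.1 / 2) :=
  ((QuotientGroup.quotientMulEquivOfEq (ker_piOneRips hX x₀).symm).trans
    (QuotientGroup.quotientKerEquivOfSurjective _ (piOneRips_surjective hX x₀))).symm

theorem piOneRipsEquiv_piOneRips (hX : IsGeodesicSpace X) (x₀ : X) (γ : FundamentalGroup X x₀) :
    piOneRipsEquiv hX r x₀ (piOneRips hX r x₀ γ) = QuotientGroup.mk γ :=
  (MulEquiv.symm_apply_eq _).2 rfl

theorem exists_piOneRipsEquiv (hX : IsGeodesicSpace X) (x₀ : X) :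
    ∃ f : ∀ r : Set.Ioi (0 : ℝ),
        FundamentalGroup (Realization (rips X r)) (vertex (rips X r) x₀) ≃*
          FundamentalGroup X x₀ ⧸ diamPiOne x₀ (3 * r.1 / 2),
      ∀ (p q : Set.Ioi (0 : ℝ)) (hpq : p ≤ q)
        (c : FundamentalGroup (Realization (rips X p)) (vertex (rips X p) x₀)),
        f q (piOneIncl (rips_mono hpq) x₀ c) = diamPiOneProj x₀ (scale_mono hpq) (f p c) := by
  refine ⟨fun r => piOneRipsEquiv hX r x₀, fun p q hpq c => ?_⟩
  obtain ⟨γ, rfl⟩ := piOneRips_surjective hX x₀ c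
  rw [piOneIncl_piOneRips hX hpq, piOneRipsEquiv_piOneRips, piOneRipsEquiv_piOneRips]
  rfl

end PiOneRips

section Hurewicz

open Path.Homotopic (Quotient)
open scoped Simplicial

variable {Y : Type u} [TopologicalSpace Y] {x y z : Y} (G : Type u) [AddCommGroup G]

variable (Y) in
/-- The complex of singular chains with coefficients in `G`. -/
noncomputable abbrev chains : ChainComplex AddCommGrpCat.{u} ℕ :=
  (TopCat.toSSet.obj (TopCat.of Y)).chainComplex (AddCommGrpCat.of G)

/-- The singular simplex given by a continuous map. -/
noncomputable def simplexOf {n : ℕ} (f : C(stdSimplex ℝ (Fin (n + 1)), Y)) :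
    (TopCat.toSSet.obj (TopCat.of Y)) _⦋n⦌ :=
  (TopCat.toSSetObjEquiv (TopCat.of Y) (Opposite.op ⦋n⦌)).symm f

theorem delta_simplexOf {n : ℕ} (f : C(stdSimplex ℝ (Fin (n + 2)), Y)) (i : Fin (n + 2)) :
    (TopCat.toSSet.obj (TopCat.of Y)).δ i (simplexOf f) =
      simplexOf (f.comp ⟨stdSimplex.map i.succAbove, stdSimplex.continuous_map _⟩) := by
  rfl

theorem exists_simplexOf_eq {n : ℕ} (σ : (TopCat.toSSet.obj (TopCat.of Y)) _⦋n⦌) :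
    ∃ f : C(stdSimplex ℝ (Fin (n + 1)), Y), simplexOf f = σ :=
  ⟨TopCat.toSSetObjEquiv (TopCat.of Y) (Opposite.op ⦋n⦌) σ, Equiv.symm_apply_apply _ _⟩

/-- The path in the standard 1-simplex from one vertex to the other. -/
noncomputable def simplexPath :
    Path (stdSimplex.vertex (S := ℝ) (0 : Fin 2)) (stdSimplex.vertex (1 : Fin 2)) where
  toFun := stdSimplexHomeomorphUnitInterval.symm
  source' := by
    rw [Homeomorph.symm_apply_eq]
    exact stdSimplexHomeomorphUnitInterval_zero.symm
  target' := by
    rw [Homeomorph.symm_apply_eq]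
    exact stdSimplexHomeomorphUnitInterval_one.symm

theorem exists_pathSimplex_eq (σ : (TopCat.toSSet.obj (TopCat.of Y)) _⦋1⦌) :
    ∃ (x y : Y) (β : Path x y), pathSimplex β = σ := by
  obtain ⟨f, rfl⟩ := exists_simplexOf_eq σ
  refine ⟨_, _, simplexPath.map f.continuous, congrArg simplexOf ?_⟩
  ext s
  exact congrArg f (stdSimplexHomeomorphUnitInterval.symm_apply_apply s)

theorem delta_zero_pathSimplex (β : Path x y) :
    (TopCat.toSSet.obj (TopCat.of Y)).δ 0 (pathSimplex β) =
      simplexOf (ContinuousMap.const (stdSimplex ℝ (Fin 1)) y) := by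
  refine (delta_simplexOf _ 0).trans (congrArg simplexOf (ContinuousMap.ext fun a => ?_))
  rw [← Subsingleton.elim (stdSimplex.vertex 0) a]
  change β (stdSimplexHomeomorphUnitInterval
    (stdSimplex.map (Fin.succAbove 0) (stdSimplex.vertex (0 : Fin 1)))) = y
  rw [stdSimplex.map_vertex]
  exact β.target

theorem delta_one_pathSimplex (β : Path x y) :
    (TopCat.toSSet.obj (TopCat.of Y)).δ 1 (pathSimplex β) =
      simplexOf (ContinuousMap.const (stdSimplex ℝ (Fin 1)) x) := by
  refine (delta_simplexOf _ 1).trans (congrArg simplexOf (ContinuousMap.ext fun a => ?_))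
  rw [← Subsingleton.elim (stdSimplex.vertex 0) a]
  change β (stdSimplexHomeomorphUnitInterval
    (stdSimplex.map (Fin.succAbove 1) (stdSimplex.vertex (0 : Fin 1)))) = x
  rw [stdSimplex.map_vertex]
  exact β.source

/-- The class of the 1-chain `g • β` modulo boundaries. -/
noncomputable def pathClass (β : Path x y) :
    AddCommGrpCat.of G ⟶ (chains Y G).opcycles 1 :=
  SSet.ιChainComplex (TopCat.toSSet.obj (TopCat.of Y)) (pathSimplex β) ≫ (chains Y G).pOpcycles 1

theorem pathClass_triangle (τ : C(stdSimplex ℝ (Fin 3), Y)) (p : Path x y) (q : Path y z)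
    (s : Path x z)
    (hp : ∀ a, τ (stdSimplex.map (Fin.succAbove 2) a) = p (stdSimplexHomeomorphUnitInterval a))
    (hq : ∀ a, τ (stdSimplex.map (Fin.succAbove 0) a) = q (stdSimplexHomeomorphUnitInterval a))
    (hs : ∀ a, τ (stdSimplex.map (Fin.succAbove 1) a) = s (stdSimplexHomeomorphUnitInterval a)) :
    pathClass G s = pathClass G p + pathClass G q := by
  have h := SSet.ιChainComplex_d (TopCat.toSSet.obj (TopCat.of Y)) (AddCommGrpCat.of G)
    (n := 1) (simplexOf τ)
  have h0 := (chains Y G).d_pOpcycles 2 1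
  have h2 : (TopCat.toSSet.obj (TopCat.of Y)).δ 2 (simplexOf τ) = pathSimplex p :=
    (delta_simplexOf τ 2).trans (congrArg simplexOf (ContinuousMap.ext hp))
  have h3 : (TopCat.toSSet.obj (TopCat.of Y)).δ 0 (simplexOf τ) = pathSimplex q :=
    (delta_simplexOf τ 0).trans (congrArg simplexOf (ContinuousMap.ext hq))
  have h4 : (TopCat.toSSet.obj (TopCat.of Y)).δ 1 (simplexOf τ) = pathSimplex s :=
    (delta_simplexOf τ 1).trans (congrArg simplexOf (ContinuousMap.ext hs))
  have h5 := congrArg (· ≫ (chains Y G).pOpcycles 1) h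
  simp only [Category.assoc] at h5
  erw [h0] at h5
  rw [Fin.sum_univ_three, h2, h3, h4] at h5
  simp only [Limits.comp_zero, Fin.val_zero, Fin.val_one, Fin.val_two, pow_zero, pow_one, one_smul,
    neg_smul, Preadditive.add_comp, Preadditive.neg_comp, even_two, Even.neg_pow, one_pow] at h5
  have h6 : pathClass G q - pathClass G s + pathClass G p = 0 := by
    rw [sub_eq_add_neg]
    exact h5.symm
  rw [← sub_eq_zero, ← neg_eq_zero, ← h6]
  abel

theorem stdSimplex_map_succAbove (a : stdSimplex ℝ (Fin 2)) :
    (stdSimplex.map (Fin.succAbove (2 : Fin 3)) a 1 = a 1 ∧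
      stdSimplex.map (Fin.succAbove (2 : Fin 3)) a 2 = 0) ∧
    (stdSimplex.map (Fin.succAbove (0 : Fin 3)) a 1 = a 0 ∧
      stdSimplex.map (Fin.succAbove (0 : Fin 3)) a 2 = a 1) ∧
    (stdSimplex.map (Fin.succAbove (1 : Fin 3)) a 1 = 0 ∧
      stdSimplex.map (Fin.succAbove (1 : Fin 3)) a 2 = a 1) := by
  have h0 : Fin.succAbove (2 : Fin 3) (0 : Fin 2) = 0 := by decide
  have h1 : Fin.succAbove (2 : Fin 3) (1 : Fin 2) = 1 := by decide
  have h2 : Fin.succAbove (0 : Fin 3) (0 : Fin 2) = 1 := by decide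
  have h3 : Fin.succAbove (0 : Fin 3) (1 : Fin 2) = 2 := by decide
  have h4 : Fin.succAbove (1 : Fin 3) (0 : Fin 2) = 0 := by decide
  have h5 : Fin.succAbove (1 : Fin 3) (1 : Fin 2) = 2 := by decide
  simp only [stdSimplex.map_coe, FunOnFinite.linearMap_apply_apply, Finset.sum_filter,
    Fin.sum_univ_two, h0, h1, h2, h3, h4, h5]
  simp

theorem simplex_sum_le (s : stdSimplex ℝ (Fin 3)) : 0 ≤ s 1 ∧ 0 ≤ s 2 ∧ s 1 + s 2 ≤ 1 := by
  have h := stdSimplex.sum_eq_one s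
  have h0 := stdSimplex.zero_le s 0
  rw [Fin.sum_univ_three] at h
  exact ⟨stdSimplex.zero_le s 1, stdSimplex.zero_le s 2, by linarith⟩

theorem continuous_stdSimplex_apply {n : ℕ} (i : Fin n) :
    Continuous fun s : stdSimplex ℝ (Fin n) => s i :=
  (continuous_apply i).comp continuous_subtype_val

theorem pathClass_trans (p : Path x y) (q : Path y z) :
    pathClass G (p.trans q) = pathClass G p + pathClass G q := by
  have h1 := continuous_stdSimplex_apply (1 : Fin 3)
  have h2 := continuous_stdSimplex_apply (2 : Fin 3)
  let m : stdSimplex ℝ (Fin 3) → I := fun s => ⟨s 1 / 2 + s 2, by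
    obtain ⟨h1, h2, h3⟩ := simplex_sum_le s
    constructor <;> linarith⟩
  have hm : Continuous m :=
    ((h1.div_const 2).add h2).subtype_mk _
  refine pathClass_triangle G ⟨fun s => p.trans q (m s), by fun_prop⟩ p q _ ?_ ?_ ?_ <;> intro a <;>
    obtain ⟨⟨e1, e2⟩, ⟨e3, e4⟩, ⟨e5, e6⟩⟩ := stdSimplex_map_succAbove a
  · have ha := stdSimplex.le_one a 1
    simp only [ContinuousMap.coe_mk, Path.trans_apply, m, e1, e2]
    rw [dif_pos (by linarith)]
    congr 1
    ext
    simp only [add_zero]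
    change 2 * (a 1 / 2) = a 1
    ring
  · have ha := stdSimplex.add_eq_one a
    have ha' := stdSimplex.zero_le a 1
    simp only [ContinuousMap.coe_mk, Path.trans_apply, m, e3, e4]
    split_ifs with h
    · have h7 : a 1 = 0 := by linarith
      have h8 : a 0 = 1 := by linarith
      have h9 : stdSimplexHomeomorphUnitInterval a = 0 := Subtype.ext h7
      rw [h9, q.source]
      convert p.target
      rw [h7, h8]
      norm_num
    · congr 1
      ext
      change 2 * (a 0 / 2 + a 1) - 1 = a 1
      linarith
  · simp only [ContinuousMap.coe_mk, m, e5, e6]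
    congr 1
    ext
    change 0 / 2 + a 1 = a 1
    ring

theorem pathClass_refl (x : Y) : pathClass G (Path.refl x) = 0 := by
  have h := pathClass_trans G (Path.refl x) (Path.refl x)
  rw [Path.refl_trans_refl] at h
  exact left_eq_add.1 h

theorem pathClass_eq_of_homotopic {p q : Path x y} (h : p.Homotopic q) :
    pathClass G p = pathClass G q := by
  obtain ⟨H⟩ := h
  have h1 := continuous_stdSimplex_apply (1 : Fin 3)
  have h2 := continuous_stdSimplex_apply (2 : Fin 3)
  let m₁ : stdSimplex ℝ (Fin 3) → I := fun s => ⟨s 1 + s 2, by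
    obtain ⟨h1, h2, h3⟩ := simplex_sum_le s
    constructor <;> linarith⟩
  let m₂ : stdSimplex ℝ (Fin 3) → I := fun s => ⟨s 2, by
    obtain ⟨h1, h2, h3⟩ := simplex_sum_le s
    constructor <;> linarith⟩
  have hm₁ : Continuous m₁ :=
    (h1.add h2).subtype_mk _
  have hm₂ : Continuous m₂ :=
    h2.subtype_mk _
  let d : Path x y :=
    { toFun := fun t => H (t, t)
      continuous_toFun := by fun_prop
      source' := by simp
      target' := by simp }
  have ht₁ := pathClass_triangle G ⟨fun s => H (m₂ s, m₁ s), by fun_prop⟩ p (Path.refl y) d (by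
    intro a
    obtain ⟨⟨e1, e2⟩, -, -⟩ := stdSimplex_map_succAbove a
    have h1 : m₁ (stdSimplex.map (Fin.succAbove 2) a) = stdSimplexHomeomorphUnitInterval a :=
      Subtype.ext (by simp only [m₁, e1, e2, add_zero]; rfl)
    have h2 : m₂ (stdSimplex.map (Fin.succAbove 2) a) = 0 := Subtype.ext e2
    simp [h1, h2]) (by
    intro a
    obtain ⟨-, ⟨e3, e4⟩, -⟩ := stdSimplex_map_succAbove a
    have h1 : m₁ (stdSimplex.map (Fin.succAbove 0) a) = 1 :=
      Subtype.ext (by simp only [m₁, e3, e4, stdSimplex.add_eq_one]; rfl)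
    rw [ContinuousMap.coe_mk, h1]
    exact H.target _) (by
    intro a
    obtain ⟨-, -, ⟨e5, e6⟩⟩ := stdSimplex_map_succAbove a
    have h1 : m₁ (stdSimplex.map (Fin.succAbove 1) a) = stdSimplexHomeomorphUnitInterval a :=
      Subtype.ext (by simp only [m₁, e5, e6, zero_add]; rfl)
    have h2 : m₂ (stdSimplex.map (Fin.succAbove 1) a) = stdSimplexHomeomorphUnitInterval a :=
      Subtype.ext e6
    simp only [ContinuousMap.coe_mk, h1, h2]
    rfl)
  have ht₂ := pathClass_triangle G ⟨fun s => H (m₁ s, m₂ s), by fun_prop⟩ (Path.refl x) q d (by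
    intro a
    obtain ⟨⟨e1, e2⟩, -, -⟩ := stdSimplex_map_succAbove a
    have h2 : m₂ (stdSimplex.map (Fin.succAbove 2) a) = 0 := Subtype.ext e2
    simp [h2]) (by
    intro a
    obtain ⟨-, ⟨e3, e4⟩, -⟩ := stdSimplex_map_succAbove a
    have h1 : m₁ (stdSimplex.map (Fin.succAbove 0) a) = 1 :=
      Subtype.ext (by simp only [m₁, e3, e4, stdSimplex.add_eq_one]; rfl)
    have h2 : m₂ (stdSimplex.map (Fin.succAbove 0) a) = stdSimplexHomeomorphUnitInterval a :=
      Subtype.ext e4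
    rw [ContinuousMap.coe_mk, h1, h2]
    exact H.apply_one _) (by
    intro a
    obtain ⟨-, -, ⟨e5, e6⟩⟩ := stdSimplex_map_succAbove a
    have h1 : m₁ (stdSimplex.map (Fin.succAbove 1) a) = stdSimplexHomeomorphUnitInterval a :=
      Subtype.ext (by simp only [m₁, e5, e6, zero_add]; rfl)
    have h2 : m₂ (stdSimplex.map (Fin.succAbove 1) a) = stdSimplexHomeomorphUnitInterval a :=
      Subtype.ext e6
    simp only [ContinuousMap.coe_mk, h1, h2]
    rfl)
  rw [pathClass_refl, add_zero] at ht₁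
  rw [pathClass_refl, zero_add] at ht₂
  rw [← ht₁, ht₂]

/-- The class modulo boundaries of a homotopy class of paths. -/
noncomputable def chainClass (p : Quotient x y) : AddCommGrpCat.of G ⟶ (chains Y G).opcycles 1 :=
  p.lift (fun β => pathClass G β) fun _ _ h => pathClass_eq_of_homotopic G h

theorem chainClass_mk (β : Path x y) : chainClass G (cls β) = pathClass G β := rfl

theorem chainClass_trans (p : Quotient x y) (q : Quotient y z) :
    chainClass G (p.trans q) = chainClass G p + chainClass G q := by
  induction p using Path.Homotopic.Quotient.ind with | mk p =>
  induction q using Path.Homotopic.Quotient.ind with | mk q =>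
  exact pathClass_trans G p q

theorem chainClass_symm (p : Quotient x y) : chainClass G p.symm = -chainClass G p := by
  refine eq_neg_of_add_eq_zero_right ?_
  rw [← chainClass_trans, Quotient.trans_symm]
  exact pathClass_refl G x

/-- The class of a loop, as a morphism to the first homology. -/
noncomputable def loopHom (β : Path x x) : AddCommGrpCat.of G ⟶ (chains Y G).homology 1 :=
  AddCommGrpCat.ofHom (loopClass G β)

theorem loopHom_homologyι (β : Path x x) :
    loopHom G β ≫ (chains Y G).homologyι 1 = pathClass G β := by
  refine (Category.assoc _ _ _).trans ?_
  erw [HomologicalComplex.homology_π_ι]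
  erw [HomologicalComplex.liftCycles_i_assoc]
  rfl

theorem homologyι_injective : Function.Injective ((chains Y G).homologyι 1).hom :=
  (AddCommGrpCat.mono_iff_injective _).1 inferInstance

theorem homologyι_loopClass (β : Path x x) (g : G) :
    ((chains Y G).homologyι 1).hom (loopClass G β g) = (chainClass G (cls β)).hom g :=
  congrArg (fun φ => AddCommGrpCat.Hom.hom φ g) (loopHom_homologyι G β)

theorem loopClass_eq_of_chainClass_eq {β : Path x x} {γ : Path y y}
    (h : chainClass G (cls β) = chainClass G (cls γ)) : loopClass G β = loopClass G γ := by
  ext g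
  apply homologyι_injective G
  rw [homologyι_loopClass, homologyι_loopClass, h]

theorem loopClass_lasso (α : Path x y) (β : Path y y) :
    loopClass G ((α.trans β).trans α.symm) = loopClass G β := by
  apply loopClass_eq_of_chainClass_eq
  rw [Quotient.mk_trans, Quotient.mk_trans, Quotient.mk_symm, chainClass_trans, chainClass_trans,
    chainClass_symm]
  abel

/-- The Hurewicz homomorphism with coefficients in `G`. -/
noncomputable def hurewicz (x : Y) : FundamentalGroup Y x →* Multiplicative (G →+ HOne G Y) where
  toFun γ := Multiplicative.ofAdd ((FundamentalGroup.toPath γ).lift (fun β => loopClass G β)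
    fun _ _ h => loopClass_eq_of_chainClass_eq G (congrArg (chainClass G) (Quotient.eq.2 h)))
  map_one' := by
    refine congrArg Multiplicative.ofAdd (AddMonoidHom.ext fun g => ?_)
    apply homologyι_injective G
    refine (homologyι_loopClass G (Path.refl x) g).trans ?_
    rw [chainClass_mk, pathClass_refl]
    exact (map_zero _).symm
  map_mul' a b := by
    obtain ⟨α, rfl⟩ := Path.Homotopic.Quotient.mk_surjective a
    obtain ⟨β, rfl⟩ := Path.Homotopic.Quotient.mk_surjective b
    refine congrArg Multiplicative.ofAdd (AddMonoidHom.ext fun g => ?_)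
    apply homologyι_injective G
    refine (homologyι_loopClass G (β.trans α) g).trans ?_
    rw [chainClass_mk, pathClass_trans, add_comm]
    exact ((AddMonoidHom.map_add ((chains Y G).homologyι 1).hom (loopClass G α g)
      (loopClass G β g)).trans (congrArg₂ (· + ·) (homologyι_loopClass G α g)
        (homologyι_loopClass G β g))).symm

theorem pathSimplex_injective {x' y' : Y} {p : Path x y} {q : Path x' y'}
    (h : pathSimplex p = pathSimplex q) (t : I) : p t = q t := by
  have h1 := (TopCat.toSSetObjEquiv (TopCat.of Y) (Opposite.op ⦋1⦌)).symm.injective h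
  have h2 := DFunLike.congr_fun h1 (stdSimplexHomeomorphUnitInterval.symm t)
  change p (stdSimplexHomeomorphUnitInterval _) = q (stdSimplexHomeomorphUnitInterval _) at h2
  rwa [Homeomorph.apply_symm_apply] at h2

/-- An edge of the standard 2-simplex. -/
noncomputable def edgePath (k : Fin 3) {i j : Fin 3} (hi : k.succAbove (0 : Fin 2) = i)
    (hj : k.succAbove (1 : Fin 2) = j) :
    Path (stdSimplex.vertex (S := ℝ) i) (stdSimplex.vertex j) :=
  (simplexPath.map (stdSimplex.continuous_map k.succAbove)).cast
    (by rw [stdSimplex.map_vertex, hi]) (by rw [stdSimplex.map_vertex, hj])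

/-- The edges of a singular 2-simplex. -/
theorem exists_triangle (τ : C(stdSimplex ℝ (Fin 3), Y)) :
    ∃ (x y z : Y) (p : Path x y) (q : Path y z) (s : Path x z),
      simplexOf (τ.comp ⟨stdSimplex.map (Fin.succAbove 2), stdSimplex.continuous_map _⟩) =
        pathSimplex p ∧
      simplexOf (τ.comp ⟨stdSimplex.map (Fin.succAbove 0), stdSimplex.continuous_map _⟩) =
        pathSimplex q ∧
      simplexOf (τ.comp ⟨stdSimplex.map (Fin.succAbove 1), stdSimplex.continuous_map _⟩) =
        pathSimplex s ∧
      cls s = (cls p).trans (cls q) := by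
  have hedge : ∀ (k : Fin 3) {i j : Fin 3} (hi : k.succAbove (0 : Fin 2) = i)
      (hj : k.succAbove (1 : Fin 2) = j),
      simplexOf (τ.comp ⟨stdSimplex.map k.succAbove, stdSimplex.continuous_map _⟩) =
        pathSimplex ((edgePath k hi hj).map τ.continuous) := by
    intro k i j hi hj
    refine congrArg simplexOf (ContinuousMap.ext fun a => ?_)
    exact congrArg (fun a => τ (stdSimplex.map k.succAbove a))
      (stdSimplexHomeomorphUnitInterval.symm_apply_apply a).symm
  have : ContractibleSpace (stdSimplex ℝ (Fin 3)) :=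
    (convex_stdSimplex ℝ _).contractibleSpace ⟨_, single_mem_stdSimplex ℝ 0⟩
  refine ⟨_, _, _, _, _, _, hedge 2 (i := 0) (j := 1) (by decide) (by decide),
    hedge 0 (i := 1) (j := 2) (by decide) (by decide),
    hedge 1 (i := 0) (j := 2) (by decide) (by decide), ?_⟩
  have hl : ∀ (k : Fin 3) {i j : Fin 3} (hi : k.succAbove (0 : Fin 2) = i)
      (hj : k.succAbove (1 : Fin 2) = j),
      Lifts τ ((edgePath k hi hj).map τ.continuous) (stdSimplex.vertex i) (stdSimplex.vertex j) :=
    fun k i j hi hj => ⟨edgePath k hi hj, fun t => rfl⟩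
  exact (hl 1 _ _).mk_eq ((hl 2 _ _).trans (hl 0 _ _))

/-- The homomorphism on singular chains that takes prescribed values on simplices. -/
noncomputable def chainDesc {n : ℕ} {A : AddCommGrpCat.{u}}
    (w : (TopCat.toSSet.obj (TopCat.of Y)) _⦋n⦌ → (AddCommGrpCat.of G ⟶ A)) :
    (chains Y G).X n ⟶ A :=
  Limits.Cofan.IsColimit.desc
    (SSet.isColimitChainComplexXCofan (TopCat.toSSet.obj (TopCat.of Y)) (AddCommGrpCat.of G) n) w

theorem ι_chainDesc {n : ℕ} {A : AddCommGrpCat.{u}}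
    (w : (TopCat.toSSet.obj (TopCat.of Y)) _⦋n⦌ → (AddCommGrpCat.of G ⟶ A))
    (σ : (TopCat.toSSet.obj (TopCat.of Y)) _⦋n⦌) :
    SSet.ιChainComplex (TopCat.toSSet.obj (TopCat.of Y)) σ ≫ chainDesc G w = w σ :=
  Limits.Cofan.IsColimit.fac _ _ σ

/-- Every homomorphism from the fundamental group of a path-connected space to an abelian group of
homomorphisms `G →+ A` factors through the Hurewicz homomorphism. -/
theorem exists_hom_of_piOne (x₀ : Y) (c : ∀ y, Path x₀ y) (A : Type u) [AddCommGroup A]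
    (b : FundamentalGroup Y x₀ →* Multiplicative (G →+ A)) :
    ∃ φ : HOne G Y →+ A, ∀ (γ : FundamentalGroup Y x₀) (g : G),
      φ ((hurewicz G x₀ γ).toAdd g) = (b γ).toAdd g := by
  let v : ∀ {x y : Y}, Quotient x y → (G →+ A) := fun {x y} p =>
    (b (FundamentalGroup.fromPath ((cls (c x)).trans (p.trans (cls (c y)).symm)))).toAdd
  have v_trans : ∀ {x y z : Y} (p : Quotient x y) (q : Quotient y z),
      v (p.trans q) = v p + v q := by
    intro x y z p q
    simp only [v]
    rw [add_comm, ← toAdd_mul, ← map_mul, FundamentalGroup.mul_def]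
    congr 2
    change _ = Quotient.trans _ _
    simp only [FundamentalGroup.fromPath, FundamentalGroup.fromArrow, Quotient.trans_assoc]
    rw [← Quotient.trans_assoc (cls (c y)).symm, Quotient.symm_trans, Quotient.refl_trans]
  have v_congr : ∀ {x y x' y' : Y} (p : Path x y) (q : Path x' y'),
      pathSimplex p = pathSimplex q → v (cls p) = v (cls q) := by
    intro x y x' y' p q h
    have h1 := pathSimplex_injective h
    obtain rfl : x = x' := by simpa using h1 0
    obtain rfl : y = y' := by simpa using h1 1
    rw [Path.ext (funext h1)]
  choose sx sy sp hsp using exists_pathSimplex_eq (Y := Y)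
  let T : (chains Y G).X 1 ⟶ AddCommGrpCat.of A := chainDesc G fun σ =>
    AddCommGrpCat.ofHom (v (cls (sp σ)))
  have hT : ∀ {x y : Y} (p : Path x y),
      SSet.ιChainComplex (TopCat.toSSet.obj (TopCat.of Y)) (pathSimplex p) ≫ T =
        AddCommGrpCat.ofHom (v (cls p)) := by
    intro x y p
    rw [ι_chainDesc, v_congr _ _ (hsp (pathSimplex p))]
  have hdT : (chains Y G).d 2 1 ≫ T = 0 := by
    refine SSet.chainComplex_hom_ext fun σ => ?_
    obtain ⟨τ, rfl⟩ := exists_simplexOf_eq σ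
    obtain ⟨x, y, z, p, q, s, hp, hq, hs, h⟩ := exists_triangle τ
    rw [SSet.ιChainComplex_d_assoc, Fin.sum_univ_three, delta_simplexOf, delta_simplexOf,
      delta_simplexOf, hp, hq, hs]
    simp only [Limits.comp_zero, Fin.val_zero, Fin.val_one, Fin.val_two, pow_zero, pow_one,
      one_smul, neg_smul, Preadditive.add_comp, Preadditive.neg_comp, even_two, Even.neg_pow,
      one_pow, hT, h, v_trans]
    ext g
    change v (cls q) g + -(v (cls p) g + v (cls q) g) + v (cls p) g = 0
    abel
  refine ⟨((chains Y G).homologyι 1 ≫ (chains Y G).descOpcycles T 2 (by simp) hdT).hom, ?_⟩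
  intro γ g
  obtain ⟨β, rfl⟩ := Path.Homotopic.Quotient.mk_surjective γ
  have h1 : loopHom G β ≫ (chains Y G).homologyι 1 ≫ (chains Y G).descOpcycles T 2 (by simp) hdT =
      AddCommGrpCat.ofHom (v (cls β)) := by
    rw [← Category.assoc, loopHom_homologyι, pathClass, Category.assoc,
      HomologicalComplex.p_descOpcycles, hT]
  have h2 : v (cls β) = (b (FundamentalGroup.fromPath (cls β))).toAdd := by
    have h3 : FundamentalGroup.fromPath
        ((cls (c x₀)).trans ((cls β).trans (cls (c x₀)).symm)) =
        (FundamentalGroup.fromPath (cls (c x₀)))⁻¹ * FundamentalGroup.fromPath (cls β) *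
          FundamentalGroup.fromPath (cls (c x₀)) := rfl
    refine congrArg Multiplicative.toAdd ((congrArg b h3).trans ?_)
    rw [map_mul, map_mul, mul_right_comm, ← map_mul, inv_mul_cancel, map_one, one_mul]
  have h4 := congrArg (fun φ => AddCommGrpCat.Hom.hom φ g) h1
  rw [h2] at h4
  exact h4

/-- A homomorphism from the first homology of a path-connected space is determined by its values on
the classes of loops at the base point. -/
theorem hom_ext_of_piOne (x₀ : Y) (c : ∀ y, Path x₀ y) {A : Type u} [AddCommGroup A]
    {φ φ' : HOne G Y →+ A}
    (h : ∀ (γ : FundamentalGroup Y x₀) (g : G),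
      φ ((hurewicz G x₀ γ).toAdd g) = φ' ((hurewicz G x₀ γ).toAdd g)) : φ = φ' := by
  choose sx sy sp hsp using exists_pathSimplex_eq (Y := Y)
  let T : (chains Y G).X 1 ⟶ (chains Y G).homology 1 := chainDesc G fun σ =>
    loopHom G (((c (sx σ)).trans (sp σ)).trans (c (sy σ)).symm)
  let K : (chains Y G).X 0 ⟶ (chains Y G).opcycles 1 := chainDesc G fun σ =>
    pathClass G (c (TopCat.toSSetObjEquiv (TopCat.of Y) (Opposite.op ⦋0⦌) σ
      (default : stdSimplex ℝ (Fin 1))))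
  have hK : ∀ y, SSet.ιChainComplex (TopCat.toSSet.obj (TopCat.of Y))
      (simplexOf (ContinuousMap.const (stdSimplex ℝ (Fin 1)) y)) ≫ K = pathClass G (c y) :=
    fun y => ι_chainDesc G _ _
  have hTK : T ≫ (chains Y G).homologyι 1 =
      (chains Y G).pOpcycles 1 - (chains Y G).d 1 0 ≫ K := by
    refine SSet.chainComplex_hom_ext fun σ => ?_
    rw [← Category.assoc, ι_chainDesc, loopHom_homologyι, Preadditive.comp_sub,
      SSet.ιChainComplex_d_assoc, Fin.sum_univ_two, pathClass_trans, pathClass_trans,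
      ← chainClass_mk G (c (sy σ)).symm, Quotient.mk_symm, chainClass_symm, chainClass_mk]
    have h0 := delta_zero_pathSimplex (sp σ)
    have h1 := delta_one_pathSimplex (sp σ)
    have h2 : SSet.ιChainComplex (TopCat.toSSet.obj (TopCat.of Y)) σ ≫
        (chains Y G).pOpcycles 1 = pathClass G (sp σ) := by
      rw [pathClass, hsp]
    rw [hsp] at h0 h1
    rw [h0, h1, h2]
    simp only [Fin.val_zero, Fin.val_one, pow_zero, pow_one, one_smul, neg_smul,
      Preadditive.add_comp, Preadditive.neg_comp, hK]
    abel
  have hπ : (chains Y G).iCycles 1 ≫ T = (chains Y G).homologyπ 1 := by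
    rw [← cancel_mono ((chains Y G).homologyι 1), Category.assoc, hTK, Preadditive.comp_sub,
      HomologicalComplex.iCycles_d_assoc, Limits.zero_comp, sub_zero,
      HomologicalComplex.homology_π_ι]
  let f : (chains Y G).homology 1 ⟶ AddCommGrpCat.of A := AddCommGrpCat.ofHom φ
  let f' : (chains Y G).homology 1 ⟶ AddCommGrpCat.of A := AddCommGrpCat.ofHom φ'
  have hff : f = f' := by
    rw [← cancel_epi ((chains Y G).homologyπ 1), ← hπ, Category.assoc, Category.assoc]
    congr 1
    refine SSet.chainComplex_hom_ext fun σ => ?_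
    rw [← Category.assoc, ← Category.assoc, ι_chainDesc]
    ext g
    exact h (FundamentalGroup.fromPath
      (cls (((c (sx σ)).trans (sp σ)).trans (c (sy σ)).symm))) g
  exact congrArg AddCommGrpCat.Hom.hom hff

theorem subsingleton_hOne [IsEmpty Y] : Subsingleton (HOne G Y) := by
  have h : 𝟙 ((chains Y G).X 1) = 0 := by
    refine SSet.chainComplex_hom_ext fun σ => ?_
    obtain ⟨x, -⟩ := exists_pathSimplex_eq σ
    exact isEmptyElim x
  have h1 : 𝟙 ((chains Y G).homology 1) = 0 := by
    rw [← cancel_epi ((chains Y G).homologyπ 1), ← cancel_mono ((chains Y G).homologyι 1),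
      Category.assoc, Category.id_comp, HomologicalComplex.homology_π_ι,
      ← Category.id_comp ((chains Y G).pOpcycles 1), h]
    simp
  have h2 : ∀ a : (chains Y G).homology 1, a = 0 := fun a =>
    congrArg (fun φ => AddCommGrpCat.Hom.hom φ a) h1
  exact ⟨fun a b => (h2 a).trans (h2 b).symm⟩

theorem hOneMap_loopClass {Z : Type u} [TopologicalSpace Z] (f : C(Y, Z)) (β : Path x x) (g : G) :
    hOneMap G f (loopClass G β g) = loopClass G (β.map f.continuous) g := by
  let φ : chains Y G ⟶ chains Z G :=
    SSet.chainComplexMap (TopCat.toSSet.map (TopCat.ofHom f)) (AddCommGrpCat.of G)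
  have h1 : (loopHom G β ≫ HomologicalComplex.homologyMap φ 1) ≫ (chains Z G).homologyι 1 =
      pathClass G (β.map f.continuous) := by
    rw [Category.assoc, HomologicalComplex.homologyι_naturality, ← Category.assoc,
      loopHom_homologyι, pathClass, Category.assoc, HomologicalComplex.p_opcyclesMap,
      ← Category.assoc, SSet.ι_chainComplexMap_f]
    rfl
  apply homologyι_injective G
  refine Eq.trans ?_ (homologyι_loopClass G (β.map f.continuous) g).symm
  exact congrArg (fun φ => AddCommGrpCat.Hom.hom φ g) h1

theorem hOneMap_hurewicz {Z : Type u} [TopologicalSpace Z] (f : C(Y, Z))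
    (γ : FundamentalGroup Y x) (g : G) :
    hOneMap G f ((hurewicz G x γ).toAdd g) =
      (hurewicz G (f x) (FundamentalGroup.map f x γ)).toAdd g := by
  obtain ⟨β, rfl⟩ := Path.Homotopic.Quotient.mk_surjective γ
  exact hOneMap_loopClass G f β g

end Hurewicz

section HOneRips

open Path.Homotopic (Quotient)
open Realization

variable {X : Type u} [MetricSpace X] {r : Set.Ioi (0 : ℝ)} (G : Type u) [AddCommGroup G]

theorem nonempty_path_vertex (hX : IsGeodesicSpace X) (x₀ : X) (u : Realization (rips X r)) :
    Nonempty (Path (vertex (rips X r) x₀) u) := by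
  obtain ⟨v, hv⟩ := exists_coord_ne_zero u
  obtain ⟨p⟩ := nonempty_rips_path (r := r) hX x₀ v
  obtain ⟨β, -⟩ := Path.Homotopic.Quotient.mk_surjective p
  exact ⟨β.trans (seg u v hv).symm⟩

theorem exists_hOneRips (hX : IsGeodesicSpace X) (r : Set.Ioi (0 : ℝ)) (x₀ : X) :
    ∃ θ : HOne G X →+ HOne G (Realization (rips X r)),
      ∀ (γ : FundamentalGroup X x₀) (g : G), θ ((hurewicz G x₀ γ).toAdd g) =
        (hurewicz G (vertex (rips X r) x₀) (piOneRips hX r x₀ γ)).toAdd g :=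
  exists_hom_of_piOne G x₀ (geod hX x₀) _
    ((hurewicz G (vertex (rips X r) x₀)).comp (piOneRips hX r x₀))

/-- The homomorphism from the first homology of `X` to that of the Rips complex. -/
noncomputable def hOneRips (hX : IsGeodesicSpace X) (r : Set.Ioi (0 : ℝ)) (x₀ : X) :
    HOne G X →+ HOne G (Realization (rips X r)) :=
  (exists_hOneRips G hX r x₀).choose

theorem hOneRips_hurewicz (hX : IsGeodesicSpace X) (x₀ : X) (γ : FundamentalGroup X x₀) (g : G) :
    hOneRips G hX r x₀ ((hurewicz G x₀ γ).toAdd g) =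
      (hurewicz G (vertex (rips X r) x₀) (piOneRips hX r x₀ γ)).toAdd g :=
  (exists_hOneRips G hX r x₀).choose_spec γ g

theorem hOneRips_surjective (hX : IsGeodesicSpace X) (x₀ : X) :
    Function.Surjective (hOneRips G hX r x₀) := by
  have h : QuotientAddGroup.mk' (hOneRips G hX r x₀).range = 0 := by
    refine hom_ext_of_piOne G (vertex (rips X r) x₀)
      (fun u => (nonempty_path_vertex hX x₀ u).some) fun γ g => ?_
    obtain ⟨δ, rfl⟩ := piOneRips_surjective hX x₀ γ
    exact (QuotientAddGroup.eq_zero_iff _).2 ⟨_, hOneRips_hurewicz G hX x₀ δ g⟩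
  intro c
  exact (QuotientAddGroup.eq_zero_iff c).1 (DFunLike.congr_fun h c)

theorem hurewicz_lasso {x₀ x : X} (α : Path x₀ x) (β : Path x x) :
    (hurewicz G x₀ (FundamentalGroup.fromPath (cls ((α.trans β).trans α.symm)))).toAdd =
      loopClass G β :=
  loopClass_lasso G α β

theorem diamHOne_le_ker (hX : IsGeodesicSpace X) (x₀ : X) :
    diamHOne X G (3 * r.1 / 2) ≤ (hOneRips G hX r x₀).ker := by
  refine (AddSubgroup.closure_le _).2 ?_
  rintro _ ⟨x, β, g, hβ, rfl⟩
  have h : FundamentalGroup.fromPath (cls (((geod hX x₀ x).trans β).trans (geod hX x₀ x).symm)) ∈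
      (piOneRips hX r x₀).ker :=
    diamPiOne_le_ker hX x₀ (Subgroup.subset_closure ⟨x, geod hX x₀ x, β, hβ, rfl⟩)
  change hOneRips G hX r x₀ (loopClass G β g) = 0
  rw [← hurewicz_lasso G (geod hX x₀ x) β, hOneRips_hurewicz, MonoidHom.mem_ker.1 h, map_one]
  rfl

theorem ker_hOneRips_le (hX : IsGeodesicSpace X) (x₀ : X) :
    (hOneRips G hX r x₀).ker ≤ diamHOne X G (3 * r.1 / 2) := by
  let π : HOne G X →+ HOne G X ⧸ diamHOne X G (3 * r.1 / 2) := QuotientAddGroup.mk' _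
  let b : FundamentalGroup X x₀ →*
      Multiplicative (G →+ HOne G X ⧸ diamHOne X G (3 * r.1 / 2)) :=
    (AddMonoidHom.toMultiplicative (AddMonoidHom.compHom π)).comp (hurewicz G x₀)
  have hb : diamPiOne x₀ (3 * r.1 / 2) ≤ b.ker := by
    refine (Subgroup.closure_le _).2 ?_
    rintro _ ⟨x, α, β, hβ, rfl⟩
    refine congrArg Multiplicative.ofAdd (AddMonoidHom.ext fun g => ?_)
    refine (QuotientAddGroup.eq_zero_iff _).2 ?_
    rw [hurewicz_lasso]
    exact AddSubgroup.subset_closure ⟨x, β, g, hβ, rfl⟩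
  obtain ⟨Φ, hΦ⟩ := exists_hom_of_piOne G (vertex (rips X r) x₀)
    (fun u => (nonempty_path_vertex hX x₀ u).some) _
    ((QuotientGroup.lift _ b hb).comp (piOneRipsEquiv hX r x₀).toMonoidHom)
  have h : Φ.comp (hOneRips G hX r x₀) = π := by
    refine hom_ext_of_piOne G x₀ (geod hX x₀) fun γ g => ?_
    rw [AddMonoidHom.comp_apply, hOneRips_hurewicz, hΦ]
    change (QuotientGroup.lift _ b hb (piOneRipsEquiv hX r x₀ (piOneRips hX r x₀ γ))).toAdd g = _
    rw [piOneRipsEquiv_piOneRips]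
    rfl
  intro c hc
  refine (QuotientAddGroup.eq_zero_iff c).1 ((DFunLike.congr_fun h c).symm.trans ?_)
  rw [AddMonoidHom.comp_apply, (AddMonoidHom.mem_ker).1 hc, map_zero]

theorem ker_hOneRips (hX : IsGeodesicSpace X) (x₀ : X) :
    (hOneRips G hX r x₀).ker = diamHOne X G (3 * r.1 / 2) :=
  le_antisymm (ker_hOneRips_le G hX x₀) (diamHOne_le_ker G hX x₀)

theorem hOneMap_hOneRips (hX : IsGeodesicSpace X) {p q : Set.Ioi (0 : ℝ)} (hpq : p ≤ q) (x₀ : X)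
    (c : HOne G X) :
    hOneMap G (incl (rips_mono hpq)) (hOneRips G hX p x₀ c) = hOneRips G hX q x₀ c := by
  have h : (hOneMap G (incl (rips_mono hpq))).comp (hOneRips G hX p x₀) =
      hOneRips G hX q x₀ := by
    refine hom_ext_of_piOne G x₀ (geod hX x₀) fun γ g => ?_
    rw [AddMonoidHom.comp_apply, hOneRips_hurewicz, hOneRips_hurewicz, hOneMap_hurewicz,
      ← piOneIncl_piOneRips hX hpq]
    rfl
  exact DFunLike.congr_fun h c

/-- The isomorphism from the first homology of the Rips complex to the quotient of the first
homology of `X` by the classes of loops of small diameter. -/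
noncomputable def hOneRipsEquiv (hX : IsGeodesicSpace X) (r : Set.Ioi (0 : ℝ)) (x₀ : X) :
    HOne G (Realization (rips X r)) ≃+ HOne G X ⧸ diamHOne X G (3 * r.1 / 2) :=
  ((QuotientAddGroup.quotientAddEquivOfEq (ker_hOneRips G hX x₀).symm).trans
    (QuotientAddGroup.quotientKerEquivOfSurjective _ (hOneRips_surjective G hX x₀))).symm

theorem hOneRipsEquiv_hOneRips (hX : IsGeodesicSpace X) (x₀ : X) (c : HOne G X) :
    hOneRipsEquiv G hX r x₀ (hOneRips G hX r x₀ c) = QuotientAddGroup.mk c :=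
  (AddEquiv.symm_apply_eq _).2 rfl

theorem isEmpty_realization [IsEmpty X] : IsEmpty (Realization (rips X r)) :=
  ⟨fun u => isEmptyElim (exists_coord_ne_zero u).choose⟩

theorem exists_hOneRipsEquiv (hX : IsGeodesicSpace X) :
    ∃ f : ∀ r : Set.Ioi (0 : ℝ),
        HOne G (Realization (rips X r)) ≃+ HOne G X ⧸ diamHOne X G (3 * r.1 / 2),
      ∀ (p q : Set.Ioi (0 : ℝ)) (hpq : p ≤ q) (c : HOne G (Realization (rips X p))),
        f q (hOneMap G (incl (rips_mono hpq)) c) =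
          diamHOneProj X G (scale_mono hpq) (f p c) := by
  rcases isEmpty_or_nonempty X with hE | ⟨⟨x₀⟩⟩
  · have h1 : Subsingleton (HOne G X) := subsingleton_hOne G
    have h2 : ∀ d, Subsingleton (HOne G X ⧸ diamHOne X G d) := fun d =>
      (QuotientAddGroup.mk'_surjective _).subsingleton
    have h3 : ∀ r, Subsingleton (HOne G (Realization (rips X r))) := fun r =>
      have := isEmpty_realization (X := X) (r := r)
      subsingleton_hOne G
    exact ⟨fun r =>
      { toFun := 0
        invFun := 0
        left_inv := fun _ => Subsingleton.elim _ _
        right_inv := fun _ => Subsingleton.elim _ _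
        map_add' := fun _ _ => Subsingleton.elim _ _ }, fun p q hpq c => Subsingleton.elim _ _⟩
  · refine ⟨fun r => hOneRipsEquiv G hX r x₀, fun p q hpq c => ?_⟩
    obtain ⟨a, rfl⟩ := hOneRips_surjective G hX x₀ c
    rw [hOneMap_hOneRips G hX hpq, hOneRipsEquiv_hOneRips, hOneRipsEquiv_hOneRips]
    rfl

end HOneRips

end RipsPersistence

theorem mainTheorem7 {X : Type u} [MetricSpace X] (hX : RipsPersistence.IsGeodesicSpace X) :
    (∀ x₀ : X,
      ∃ f : ∀ r : Set.Ioi (0 : ℝ),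
          FundamentalGroup (RipsPersistence.Realization (RipsPersistence.rips X r))
              (RipsPersistence.Realization.vertex (RipsPersistence.rips X r) x₀) ≃*
            FundamentalGroup X x₀ ⧸ RipsPersistence.diamPiOne x₀ (3 * r.1 / 2),
        ∀ (p q : Set.Ioi (0 : ℝ)) (hpq : p ≤ q)
          (c : FundamentalGroup (RipsPersistence.Realization (RipsPersistence.rips X p))
            (RipsPersistence.Realization.vertex (RipsPersistence.rips X p) x₀)),
          f q (RipsPersistence.piOneIncl (RipsPersistence.rips_mono hpq) x₀ c) =
            RipsPersistence.diamPiOneProj x₀ (RipsPersistence.scale_mono hpq) (f p c)) ∧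
    (∀ (G : Type u) [AddCommGroup G],
      ∃ f : ∀ r : Set.Ioi (0 : ℝ),
          RipsPersistence.HOne G (RipsPersistence.Realization (RipsPersistence.rips X r)) ≃+
            RipsPersistence.HOne G X ⧸ RipsPersistence.diamHOne X G (3 * r.1 / 2),
        ∀ (p q : Set.Ioi (0 : ℝ)) (hpq : p ≤ q)
          (c : RipsPersistence.HOne G
            (RipsPersistence.Realization (RipsPersistence.rips X p))),
          f q (RipsPersistence.hOneMap G
              (RipsPersistence.Realization.incl (RipsPersistence.rips_mono hpq)) c) =
            RipsPersistence.diamHOneProj X G (RipsPersistence.scale_mono hpq) (f p c)) :=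
  ⟨fun x₀ => RipsPersistence.exists_piOneRipsEquiv hX x₀,
    fun G _ => RipsPersistence.exists_hOneRipsEquiv G hX⟩
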